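/- Closest String. An instance consists of $k \ge 1$ strings $s_1,\dots,s_k$ of length $L \ge 1$ over the alphabet $[k]=\{1,\dots,k\}$ and an integer $d \ge 0$; a closest string is a $c \in [k]^L$ whose Hamming distance to every $s_i$ is at most $d$. The column at position $j$ is the vector of the $j$-th letters of $s_1,\dots,s_k$. Two columns $u,v \in [k]^k$ are of the same column type if, for all $1 \le i < j \le k$, $u_i = u_j$ if and only if $v_i = v_j$. Let $T$ be the number of column types that occur among the $L$ columns of the strings. The strings are given succinctly, by $k$, $L$, $d$, $T$, one representative column $f_1,\dots,f_T \in [k]^k$ of each occurring type, and the number $b^t$ of positions of each type $t$. A solution is given succinctly, too: by a table of numbers $x_{t,e}$ ($t \in [T]$, $e \in [k]$), where $x_{t,e}$ is the number of positions of type $t$ at which $c$ has the letter that corresponds to $e$ when the letters at that position are renamed so that its column becomes $f_t$. Theorem. Closest String can be solved in time $((T+1)k)^{O(k)} \log L$. Precisely: there are a word RAM program $P$ (unit-cost addition, truncated subtraction, multiplication, integer division, constants, indirect loads and stores, branches and loops) and a constant $C \in \mathbb{N}$ such that, for every instance, every choice of the representatives, and every word length $w$ with $2^w \ge ((T+1)k)^{Ck}(L+d)$,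 the program $P$, started on the succinct input on a machine with $w$-bit words, halts after at most $$((T+1)k)^{Ck} \cdot \max(1, \log_2 L)$$ steps, and either outputs a table that describes at least one string and describes only closest strings, or correctly reports that there is no closest string. -/

import Mathlib

namespace ClosestString

section WordRAM

/-- The state of a word RAM: registers and a random access memory, both holding words. -/
structure State where
  /-- contents of the registers -/
  reg : ℕ → ℕ
  /-- contents of the memory cells -/
  mem : ℕ → ℕ

/-- The arithmetic instructions. -/
inductive Op
  | add
  | sub
  | mul
  | div

/-- Arithmetic on words of `w` bits: sums and products are reduced modulo `2 ^ w`, subtraction is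
truncated at `0`, division is integer division. -/
def Op.eval (w : ℕ) : Op → ℕ → ℕ → ℕ
  | .add, x, y => (x + y) % 2 ^ w
  | .sub, x, y => x - y
  | .mul, x, y => (x * y) % 2 ^ w
  | .div, x, y => x / y

/-- Word RAM programs with structured control flow. A program is a fixed finite text. It does not
depend on the input or on the word length, and it mentions only finitely many registers. -/
inductive Prog
  /-- do nothing -/
  | skip
  /-- `reg a := v` -/
  | const (a v : ℕ)
  /-- `reg a := reg b o reg c` -/
  | op (o : Op) (a b c : ℕ)
  /-- `reg a := mem (reg b)` -/
  | load (a b : ℕ)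
  /-- `mem (reg a) := reg b` -/
  | store (a b : ℕ)
  /-- first `p`, then `q` -/
  | seq (p q : Prog)
  /-- if `reg a ≠ 0` then `p` else `q` -/
  | ite (a : ℕ) (p q : Prog)
  /-- while `reg a ≠ 0` do `p` -/
  | loop (a : ℕ) (p : Prog)

/-- `Exec w p σ n τ`: on a machine with words of `w` bits, the program `p` started in the state `σ`
halts after exactly `n` steps in the state `τ`. Every instruction and every evaluation of a
branching or loop condition is one step. -/
inductive Exec (w : ℕ) : Prog → State → ℕ → State → Prop
  | skip (σ : State) : Exec w .skip σ 0 σ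
  | const (a v : ℕ) (σ : State) :
      Exec w (.const a v) σ 1 ⟨Function.update σ.reg a (v % 2 ^ w), σ.mem⟩
  | op (o : Op) (a b c : ℕ) (σ : State) :
      Exec w (.op o a b c) σ 1
        ⟨Function.update σ.reg a (o.eval w (σ.reg b) (σ.reg c)), σ.mem⟩
  | load (a b : ℕ) (σ : State) :
      Exec w (.load a b) σ 1 ⟨Function.update σ.reg a (σ.mem (σ.reg b)), σ.mem⟩
  | store (a b : ℕ) (σ : State) :
      Exec w (.store a b) σ 1 ⟨σ.reg, Function.update σ.mem (σ.reg a) (σ.reg b)⟩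
  | seq {p q : Prog} {σ τ υ : State} {m n : ℕ} :
      Exec w p σ m τ → Exec w q τ n υ → Exec w (.seq p q) σ (m + n) υ
  | ite_true {a : ℕ} {p q : Prog} {σ τ : State} {n : ℕ} :
      σ.reg a ≠ 0 → Exec w p σ n τ → Exec w (.ite a p q) σ (n + 1) τ
  | ite_false {a : ℕ} {p q : Prog} {σ τ : State} {n : ℕ} :
      σ.reg a = 0 → Exec w q σ n τ → Exec w (.ite a p q) σ (n + 1) τ
  | loop_true {a : ℕ} {p : Prog} {σ τ υ : State} {m n : ℕ} :
      σ.reg a ≠ 0 → Exec w p σ m τ → Exec w (.loop a p) τ n υ →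
        Exec w (.loop a p) σ (m + n + 1) υ
  | loop_false {a : ℕ} {p : Prog} {σ : State} :
      σ.reg a = 0 → Exec w (.loop a p) σ 1 σ

/-- The initial state: the input is in the memory cells `0, 1, 2, …`, everything else is `0`. -/
def initState (input : List ℕ) : State where
  reg := fun _ => 0
  mem := fun n => input.getD n 0

end WordRAM

section Problem

variable {k L : ℕ}

/-- `c` is a solution of the Closest String instance given by the `k` strings `s i` of length `L`
over an alphabet with `k` letters and by the bound `d`. -/
def IsClosest (s : Fin k → Fin L → Fin k) (d : ℕ) (c : Fin L → Fin k) : Prop :=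
  ∀ i, hammingDist c (s i) ≤ d

/-- Two columns are of the same column type. -/
def SameType (c c' : Fin k → Fin k) : Prop :=
  ∀ i j, i < j → (c i = c j ↔ c' i = c' j)

/-- "Being of the same column type" as an equivalence relation. -/
def columnSetoid (k : ℕ) : Setoid (Fin k → Fin k) where
  r := SameType
  iseqv := ⟨fun _ _ _ _ => Iff.rfl, fun h i j hij => (h i j hij).symm,
    fun h h' i j hij => (h i j hij).trans (h' i j hij)⟩

/-- The column of the strings at position `j`. -/
def column (s : Fin k → Fin L → Fin k) (j : Fin L) : Fin k → Fin k := fun i => s i j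

/-- The number `T` of column types that occur in the strings. -/
noncomputable def numTypes (s : Fin k → Fin L → Fin k) : ℕ :=
  (Set.range fun j => (Quotient.mk (columnSetoid k) (column s j))).ncard

/-- `rep` lists the column types that occur in the strings, each of them once, by a representative
(which may be any column of that type). -/
def IsTypeListing (s : Fin k → Fin L → Fin k) (rep : Fin (numTypes s) → Fin k → Fin k) : Prop :=
  (∀ t, ∃ j, SameType (column s j) (rep t)) ∧ ∀ j, ∃! t, SameType (column s j) (rep t)

/-- The number of positions whose column is of the type of `rep t`. -/
noncomputable def mult (s : Fin k → Fin L → Fin k) (rep : Fin (numTypes s) → Fin k → Fin k)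
    (t : Fin (numTypes s)) : ℕ :=
  {j | SameType (column s j) (rep t)}.ncard

/-- The input: `k`, `L`, `d`, `T`, then the `T` representatives of the column types (each as `k`
letters), then the `T` multiplicities. -/
noncomputable def encode (s : Fin k → Fin L → Fin k) (d : ℕ)
    (rep : Fin (numTypes s) → Fin k → Fin k) : List ℕ :=
  [k, L, d, numTypes s]
    ++ (List.ofFn fun t => List.ofFn fun i => (rep t i : ℕ)).flatten
    ++ List.ofFn (mult s rep)

/-- The table `x` describes the string `c`: among the positions of type `t`, the string `c` agrees
with `s i` exactly `x t (rep t i)` times, and the entries of `x` at letters that do not occur in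
`rep t` account for the positions of type `t` where `c` agrees with none of the strings. In other
words, `x t e` counts the positions of type `t` at which `c` has the letter that corresponds to `e`
when the letters of the column are renamed so that the column becomes `rep t`. -/
def Describes (s : Fin k → Fin L → Fin k) (rep : Fin (numTypes s) → Fin k → Fin k)
    (x : Fin (numTypes s) → Fin k → ℕ) (c : Fin L → Fin k) : Prop :=
  (∀ t, ∑ e, x t e = mult s rep t) ∧
    ∀ t i, x t (rep t i) = {j | SameType (column s j) (rep t) ∧ c j = s i j}.ncard

/-- The table in the memory cells `0, …, T * k - 1`, row by row. -/
def outputTable (s : Fin k → Fin L → Fin k) (σ : State) : Fin (numTypes s) → Fin k → ℕ :=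
  fun t e => σ.mem (t * k + e)

/-- The final state `σ` solves the instance: either register `0` holds `1`, and the output table
describes a string and every string it describes is a closest string; or register `0` holds `0`,
and there is no closest string. -/
def Solves (s : Fin k → Fin L → Fin k) (d : ℕ) (rep : Fin (numTypes s) → Fin k → Fin k)
    (σ : State) : Prop :=
  (σ.reg 0 = 1 ∧ (∃ c, Describes s rep (outputTable s σ) c) ∧
      ∀ c, Describes s rep (outputTable s σ) c → IsClosest s d c) ∨
    (σ.reg 0 = 0 ∧ ¬ ∃ c, IsClosest s d c)

end Problem

end ClosestString

/-! A string matters only through its table $x_{t,e}$: its distance to $s_i$ is $L-\sum_t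
x_{t,f_t(i)}$. Conversely, every table with row sums $b^t$ is realised by a string
(`exists_describes`, `exists_sol`). So one needs a table with these row sums in which the $k$
agreement sums are all at least $L-d$.

The table is built in binary levels; a letter chosen at level $j$ stands for $2^j$ positions.
Rounding the $k$ entries of a row down to even numbers loses at most $k$. Therefore, whatever the
solution is, a number `lev t (j + 1)` that depends on $b^t$ only can be left to the higher levels
(`exists_half`), and level $j$ chooses at most $k+1$ letters for each type (`cnt_le`). About $\log L
+ k$ levels exhaust all rows.

For each string only a carry is remembered: the agreements so far, divided by $2^j$ and rounded
down. This loses nothing, since all later contributions are multiples of $2^j$. The number `G` is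
added bit by bit and moves the threshold $L-d$ to $2^J$, where it can be read off the last carry
(`check_iff`). A level adds at most $T(k+1)$ to a carry and then halves it, so carries are $O(Tk)$
and there are at most $B^k$ states, with $B=O(Tk)$. `Sem.next` shows that paths of states come from
tables, `Rem.next` that every solution can be followed by a path.

The program tabulates backwards, for each step and state, a letter that leads to a good final state,
and then replays the choices from state $0$. Running time and absence of overflow are tracked by the
predicate `WP`. -/

namespace ClosestString

/-! ### Compiling expressions to the word RAM, and a calculus for total correctness with step
bounds. -/

/-- The variables of the program. They are kept in the registers below `64`. -/
inductive Var
  | ans | k | L | d | T | K | S | B | N | G | J | X | Q | Z | H | E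
  | n | c | e | i | j | s | t | pw | act | md | u | a | cc | P | new | dig
  deriving DecidableEq

/-- The register that holds a variable. -/
def Var.idx (x : Var) : ℕ := x.ctorIdx

theorem Var.idx_lt (x : Var) : x.idx < 64 := by cases x <;> decide

theorem Var.idx_injective : Function.Injective Var.idx := by
  intro x y h
  rw [← Var.ofNat_ctorIdx x, ← Var.ofNat_ctorIdx y]
  exact congrArg Var.ofNat h

/-- A state seen from the program: the values of the variables, and the memory. -/
structure View where
  /-- values of the variables -/
  reg : Var → ℕ
  /-- contents of the memory cells -/
  mem : ℕ → ℕ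

/-- Assignment to a variable. -/
def View.set (σ : View) (x : Var) (v : ℕ) : View := ⟨fun y => if y = x then v else σ.reg y, σ.mem⟩

/-- Assignment to a memory cell. -/
def View.put (σ : View) (a v : ℕ) : View := ⟨σ.reg, fun b => if b = a then v else σ.mem b⟩

@[simp] theorem View.set_reg (σ : View) (x y : Var) (v : ℕ) :
    (σ.set x v).reg y = if y = x then v else σ.reg y := rfl

@[simp] theorem View.set_mem (σ : View) (x : Var) (v : ℕ) : (σ.set x v).mem = σ.mem := rfl

@[simp] theorem View.put_reg (σ : View) (a v : ℕ) : (σ.put a v).reg = σ.reg := rfl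

@[simp] theorem View.put_mem (σ : View) (a v b : ℕ) :
    (σ.put a v).mem b = if b = a then v else σ.mem b := rfl

/-- `σ` is the view of the state `τ`. -/
def Agree (σ : View) (τ : State) : Prop := (∀ x, τ.reg x.idx = σ.reg x) ∧ τ.mem = σ.mem

/-- Arithmetic expressions in the variables and the memory. -/
inductive Expr
  | lit (v : ℕ)
  | var (x : Var)
  | bin (o : Op) (a b : Expr)
  | get (a : Expr)

namespace Expr

/-- The variable `x` as an expression. -/
abbrev v (x : Var) : Expr := .var x

instance : Add Expr := ⟨.bin .add⟩
instance : Sub Expr := ⟨.bin .sub⟩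
instance : Mul Expr := ⟨.bin .mul⟩
instance : Div Expr := ⟨.bin .div⟩
instance (n : ℕ) : OfNat Expr n := ⟨.lit n⟩

/-- The value of an expression in the natural numbers. -/
def eval (σ : View) : Expr → ℕ
  | lit v => v
  | var x => σ.reg x
  | bin .add a b => a.eval σ + b.eval σ
  | bin .sub a b => a.eval σ - b.eval σ
  | bin .mul a b => a.eval σ * b.eval σ
  | bin .div a b => a.eval σ / b.eval σ
  | get a => σ.mem (a.eval σ)

/-- The evaluation of an expression does not overflow if the words are the numbers below `W`. -/
def Safe (W : ℕ) (σ : View) : Expr → Prop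
  | lit v => v < W
  | var _ => True
  | bin .add a b => a.Safe W σ ∧ b.Safe W σ ∧ a.eval σ + b.eval σ < W
  | bin .sub a b => a.Safe W σ ∧ b.Safe W σ
  | bin .mul a b => a.Safe W σ ∧ b.Safe W σ ∧ a.eval σ * b.eval σ < W
  | bin .div a b => a.Safe W σ ∧ b.Safe W σ
  | get a => a.Safe W σ

/-- The number of steps that the evaluation of an expression takes. -/
def cost : Expr → ℕ
  | lit _ => 1
  | var _ => 2
  | bin _ a b => a.cost + b.cost + 1
  | get a => a.cost + 1

/-- Code that evaluates an expression into the register `r`, with scratch registers above it. -/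
def code : Expr → ℕ → Prog
  | lit v, r => .const r v
  -- There is no copy instruction; subtracting zero copies a register.
  | var x, r => .seq (.const r 0) (.op .sub r x.idx r)
  | bin o a b, r => .seq (a.code r) (.seq (b.code (r + 1)) (.op o r r (r + 1)))
  | get a, r => .seq (a.code r) (.load r r)

variable {W : ℕ} {σ : View} (a b : Expr) (n : ℕ) (x : Var)

@[simp] theorem eval_ofNat : (ofNat(n) : Expr).eval σ = n := rfl
@[simp] theorem eval_var : (Expr.var x).eval σ = σ.reg x := rfl
@[simp] theorem eval_add : (a + b).eval σ = a.eval σ + b.eval σ := rfl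
@[simp] theorem eval_sub : (a - b).eval σ = a.eval σ - b.eval σ := rfl
@[simp] theorem eval_mul : (a * b).eval σ = a.eval σ * b.eval σ := rfl
@[simp] theorem eval_div : (a / b).eval σ = a.eval σ / b.eval σ := rfl
@[simp] theorem eval_get : (get a).eval σ = σ.mem (a.eval σ) := rfl

@[simp] theorem safe_ofNat : (ofNat(n) : Expr).Safe W σ ↔ n < W := Iff.rfl
@[simp] theorem safe_var : (Expr.var x).Safe W σ ↔ True := Iff.rfl
@[simp] theorem safe_add : (a + b).Safe W σ ↔
    a.Safe W σ ∧ b.Safe W σ ∧ a.eval σ + b.eval σ < W := Iff.rfl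
@[simp] theorem safe_sub : (a - b).Safe W σ ↔ a.Safe W σ ∧ b.Safe W σ := Iff.rfl
@[simp] theorem safe_mul : (a * b).Safe W σ ↔
    a.Safe W σ ∧ b.Safe W σ ∧ a.eval σ * b.eval σ < W := Iff.rfl
@[simp] theorem safe_div : (a / b).Safe W σ ↔ a.Safe W σ ∧ b.Safe W σ := Iff.rfl
@[simp] theorem safe_get : (get a).Safe W σ ↔ a.Safe W σ := Iff.rfl

@[simp] theorem cost_ofNat : (ofNat(n) : Expr).cost = 1 := rfl
@[simp] theorem cost_var : (Expr.var x).cost = 2 := rfl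
@[simp] theorem cost_add : (a + b).cost = a.cost + b.cost + 1 := rfl
@[simp] theorem cost_sub : (a - b).cost = a.cost + b.cost + 1 := rfl
@[simp] theorem cost_mul : (a * b).cost = a.cost + b.cost + 1 := rfl
@[simp] theorem cost_div : (a / b).cost = a.cost + b.cost + 1 := rfl
@[simp] theorem cost_get : (get a).cost = a.cost + 1 := rfl

end Expr

theorem Agree.of_eq {σ : View} {τ τ' : State} (h : Agree σ τ) {r : ℕ} (hr : 64 ≤ r)
    (hreg : ∀ q < r, τ'.reg q = τ.reg q) (hmem : τ'.mem = τ.mem) : Agree σ τ' :=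
  ⟨fun x => (hreg _ (x.idx_lt.trans_le hr)).trans (h.1 x), hmem.trans h.2⟩

theorem Exec.cast_steps {w : ℕ} {p : Prog} {σ τ : State} {n n' : ℕ} (h : Exec w p σ n τ)
    (hn : n = n') : Exec w p σ n' τ := hn ▸ h

/-- Code compiled at `r` leaves the registers below `r` alone. This protects the variables, and also
the left operand of a binary operation while the right one is evaluated at `r + 1`. -/
theorem Expr.exec_code {w : ℕ} {σ : View} (e : Expr) (he : e.Safe (2 ^ w) σ) {τ : State}
    (hτ : Agree σ τ) {r : ℕ} (hr : 64 ≤ r) :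
    ∃ τ' : State, Exec w (e.code r) τ e.cost τ' ∧ τ'.mem = τ.mem ∧
      (∀ q < r, τ'.reg q = τ.reg q) ∧ τ'.reg r = e.eval σ := by
  induction e generalizing τ r with
  | lit v =>
    refine ⟨_, Exec.const _ _ _, rfl, fun q hq => ?_, ?_⟩
    · simp [Function.update_of_ne hq.ne]
    · simpa [eval] using Nat.mod_eq_of_lt he
  | var x =>
    refine ⟨_, Exec.seq (Exec.const _ _ _) (Exec.op _ _ _ _ _), rfl, fun q hq => ?_, ?_⟩
    · simp [Function.update_of_ne hq.ne]
    · have : x.idx ≠ r := (x.idx_lt.trans_le hr).ne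
      simp [Op.eval, eval, this, hτ.1 x]
  | bin o a b iha ihb =>
    have ha : a.Safe (2 ^ w) σ := by cases o <;> exact he.1
    have hb : b.Safe (2 ^ w) σ := by
      cases o
      exacts [he.2.1, he.2, he.2.1, he.2]
    obtain ⟨τ₁, h₁, hm₁, hq₁, hv₁⟩ := iha ha hτ hr
    have hτ₁ := hτ.of_eq hr hq₁ hm₁
    obtain ⟨τ₂, h₂, hm₂, hq₂, hv₂⟩ := ihb hb hτ₁ (r := r + 1) (by omega)
    have hv := hq₂ r (by omega)
    refine ⟨_, (h₁.seq (h₂.seq (Exec.op o r r (r + 1) τ₂))).cast_steps (add_assoc _ _ _).symm,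
      hm₂.trans hm₁, fun q hq => ?_, ?_⟩
    · simp [Function.update_of_ne hq.ne, hq₂ q (by omega), hq₁ q hq]
    · cases o
      · simpa [Op.eval, eval, hv, hv₁, hv₂] using Nat.mod_eq_of_lt he.2.2
      · simp [Op.eval, eval, hv, hv₁, hv₂]
      · simpa [Op.eval, eval, hv, hv₁, hv₂] using Nat.mod_eq_of_lt he.2.2
      · simp [Op.eval, eval, hv, hv₁, hv₂]
  | get a iha =>
    obtain ⟨τ₁, h₁, hm₁, hq₁, hv₁⟩ := iha he hτ hr
    refine ⟨_, h₁.seq (Exec.load _ _ _), hm₁, fun q hq => ?_, ?_⟩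
    · simp [Function.update_of_ne hq.ne, hq₁ q hq]
    · simp [eval, hv₁, hm₁, hτ.2]

/-- `x := e` -/
def Prog.assign (x : Var) (e : Expr) : Prog :=
  .seq (e.code 64) (.seq (.const 65 0) (.op .sub x.idx 64 65))

/-- `mem a := e` -/
def Prog.put (a e : Expr) : Prog :=
  .seq (a.code 64) (.seq (e.code 65) (.store 64 65))

/-- If `e ≠ 0` then `p` else `q`. -/
def Prog.cond (e : Expr) (p q : Prog) : Prog := .seq (e.code 64) (.ite 64 p q)

/-- While `e ≠ 0` do `p`. -/
def Prog.whileLoop (e : Expr) (p : Prog) : Prog := .seq (e.code 64) (.loop 64 (.seq p (e.code 64)))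

/-- For `x` from `0` to `e - 1` do `p`. -/
def Prog.forLoop (x : Var) (e : Expr) (p : Prog) : Prog :=
  .seq (.assign x 0) (.whileLoop (e - .v x) (.seq p (.assign x (.v x + 1))))

/-- With words below `W`, and started in any state with the view `σ`, the program `p` halts within
`n` steps in a state whose view satisfies `R`. -/
def WP (W : ℕ) (p : Prog) (n : ℕ) (R : View → Prop) (σ : View) : Prop :=
  ∀ w, 2 ^ w = W → ∀ τ, Agree σ τ →
    ∃ n' ≤ n, ∃ τ' σ', Exec w p τ n' τ' ∧ Agree σ' τ' ∧ R σ'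

namespace WP

variable {W : ℕ} {σ : View} {R : View → Prop}

theorem mono {p : Prog} {n n' : ℕ} {R' : View → Prop} (h : WP W p n R σ) (hn : n ≤ n')
    (hR : ∀ τ, R τ → R' τ) : WP W p n' R' σ := fun w hw τ hτ =>
  let ⟨l, hl, τ', σ', he, ha, hr⟩ := h w hw τ hτ
  ⟨l, hl.trans hn, τ', σ', he, ha, hR _ hr⟩

theorem seq {p q : Prog} {m n : ℕ} (h : WP W p m (WP W q n R) σ) :
    WP W (.seq p q) (m + n) R σ := fun w hw τ hτ =>
  let ⟨l, hl, τ', _, he, ha, hr⟩ := h w hw τ hτ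
  let ⟨l', hl', τ'', σ'', he', ha', hr'⟩ := hr w hw τ' ha
  ⟨l + l', add_le_add hl hl', τ'', σ'', he.seq he', ha', hr'⟩

theorem skip (h : R σ) : WP W .skip 0 R σ := fun _ _ τ hτ =>
  ⟨0, le_rfl, τ, σ, .skip τ, hτ, h⟩

theorem assign {x : Var} {e : Expr} (v : ℕ) (he : e.Safe W σ) (hv : e.eval σ = v)
    (h : R (σ.set x v)) : WP W (.assign x e) (e.cost + 2) R σ := by
  rintro w rfl τ hτ
  obtain ⟨τ₁, h₁, hm₁, hq₁, hv₁⟩ := e.exec_code he hτ le_rfl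
  refine ⟨_, le_rfl, _, _, h₁.seq ((Exec.const _ _ _).seq (Exec.op _ _ _ _ _)), ?_, h⟩
  refine ⟨fun y => ?_, hm₁.trans hτ.2⟩
  by_cases hy : y = x
  · subst hy
    simp [Op.eval, hv₁, hv]
  · have hi : y.idx ≠ x.idx := fun h => hy (Var.idx_injective h)
    have h65 : y.idx ≠ 65 := by have := y.idx_lt; omega
    simp [hi, hy, h65, hq₁ _ y.idx_lt, hτ.1 y]

theorem put {a e : Expr} (u v : ℕ) (ha : a.Safe W σ) (he : e.Safe W σ) (hu : a.eval σ = u)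
    (hv : e.eval σ = v) (h : R (σ.put u v)) : WP W (.put a e) (a.cost + (e.cost + 1)) R σ := by
  rintro w rfl τ hτ
  obtain ⟨τ₁, h₁, hm₁, hq₁, hv₁⟩ := a.exec_code ha hτ le_rfl
  obtain ⟨τ₂, h₂, hm₂, hq₂, hv₂⟩ := e.exec_code he (hτ.of_eq le_rfl hq₁ hm₁) (r := 65) (by omega)
  refine ⟨_, le_rfl, _, _, h₁.seq (h₂.seq (Exec.store _ _ _)), ⟨fun y => ?_, ?_⟩, h⟩
  · have := y.idx_lt
    simp [hq₂ y.idx (by omega), hq₁ y.idx (by omega), hτ.1 y]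
  · have := hq₂ 64 (by omega)
    ext b
    simp [this, hv₁, hv₂, hm₂, hm₁, hτ.2, Function.update_apply, hu, hv]

theorem cond {e : Expr} {p q : Prog} {m n : ℕ} (he : e.Safe W σ)
    (hp : e.eval σ ≠ 0 → WP W p m R σ) (hq : e.eval σ = 0 → WP W q n R σ) :
    WP W (.cond e p q) (e.cost + (max m n + 1)) R σ := by
  rintro w rfl τ hτ
  obtain ⟨τ₁, h₁, hm₁, hq₁, hv₁⟩ := e.exec_code he hτ le_rfl
  have hτ₁ := hτ.of_eq le_rfl hq₁ hm₁
  by_cases h0 : e.eval σ = 0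
  · obtain ⟨l, hl, τ', σ', hx, ha, hr⟩ := hq h0 w rfl τ₁ hτ₁
    exact ⟨_, by omega, τ', σ', h₁.seq (.ite_false (hv₁.trans h0) hx), ha, hr⟩
  · obtain ⟨l, hl, τ', σ', hx, ha, hr⟩ := hp h0 w rfl τ₁ hτ₁
    exact ⟨_, by omega, τ', σ', h₁.seq (.ite_true (by rwa [hv₁]) hx), ha, hr⟩

/-- The invariant is indexed by the number of completed rounds, and the condition holds exactly in
the rounds below `n`. So the number of rounds is known and no separate termination measure is
needed. -/
theorem whileLoop {e : Expr} {p : Prog} {c : ℕ} (Inv : ℕ → View → Prop) (n : ℕ) (h0 : Inv 0 σ)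
    (he : ∀ j τ, j ≤ n → Inv j τ → e.Safe W τ ∧ (e.eval τ ≠ 0 ↔ j < n))
    (hp : ∀ j τ, j < n → Inv j τ → WP W p c (Inv (j + 1)) τ) (hR : ∀ τ, Inv n τ → R τ) :
    WP W (.whileLoop e p) (e.cost + (n * (c + e.cost + 1) + 1)) R σ := by
  rintro w rfl τ hτ
  obtain ⟨τ₁, h₁, hm₁, hq₁, hv₁⟩ := e.exec_code (he 0 σ (by omega) h0).1 hτ le_rfl
  suffices H : ∀ m j σ τ, j + m = n → Inv j σ → Agree σ τ → τ.reg 64 = e.eval σ →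
      ∃ l ≤ m * (c + e.cost + 1) + 1, ∃ τ' σ', Exec w (.loop 64 (.seq p (e.code 64))) τ l τ' ∧
        Agree σ' τ' ∧ R σ' by
    obtain ⟨l, hl, τ', σ', hx, ha, hr⟩ := H n 0 σ τ₁ (by omega) h0 (hτ.of_eq le_rfl hq₁ hm₁) hv₁
    exact ⟨_, by omega, τ', σ', h₁.seq hx, ha, hr⟩
  clear h₁ hm₁ hq₁ hv₁ τ₁ hτ τ h0
  intro m
  induction m with
  | zero =>
    intro j σ τ hj hi hτ hv
    obtain rfl : j = n := hj
    refine ⟨1, by omega, τ, σ, .loop_false ?_, hτ, hR _ hi⟩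
    have := (he j σ le_rfl hi).2
    by_contra h
    exact absurd (this.1 (by rwa [← hv])) (lt_irrefl _)
  | succ m ih =>
    intro j σ τ hj hi hτ hv
    have hne := (he j σ (by omega) hi).2.2 (by omega)
    obtain ⟨l, hl, τ₁, σ₁, hx, ha, hi₁⟩ := hp j σ (by omega) hi w rfl τ hτ
    obtain ⟨τ₂, h₂, hm₂, hq₂, hv₂⟩ := e.exec_code (he (j + 1) σ₁ (by omega) hi₁).1 ha le_rfl
    obtain ⟨l', hl', τ', σ', hx', ha', hr'⟩ :=
      ih (j + 1) σ₁ τ₂ (by omega) hi₁ (ha.of_eq le_rfl hq₂ hm₂) hv₂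
    refine ⟨_, ?_, τ', σ', .loop_true (by rwa [hv]) (hx.seq h₂) hx', ha', hr'⟩
    rw [add_mul]
    omega

/-- The body has to leave the counter as it was; `n < W` keeps the increment from overflowing. -/
theorem forLoop {x : Var} {e : Expr} {p : Prog} {c : ℕ} (Inv : ℕ → View → Prop) (n : ℕ)
    (hn : n < W) (h0 : Inv 0 (σ.set x 0))
    (he : ∀ j τ, Inv j τ → e.Safe W τ ∧ e.eval τ = n ∧ τ.reg x = j)
    (hp : ∀ j τ, j < n → Inv j τ →
      WP W p c (fun υ => υ.reg x = j ∧ Inv (j + 1) (υ.set x (j + 1))) τ)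
    (hR : ∀ τ, Inv n τ → R τ) :
    WP W (.forLoop x e p) (3 + (e.cost + 3 + (n * (c + 6 + (e.cost + 3) + 1) + 1))) R σ := by
  refine seq (assign 0 (by change 0 < _; omega) rfl ?_)
  refine whileLoop Inv n h0 (fun j τ _ hi => ?_) (fun j τ hj hi => ?_) hR
  · obtain ⟨h₁, h₂, h₃⟩ := he j τ hi
    simp [h₁, h₂, h₃, Nat.sub_eq_zero_iff_le]
  · refine seq ((hp j τ hj hi).mono le_rfl fun υ ⟨hx, hυ⟩ => ?_)
    have hs : (Expr.v x + 1).Safe W υ :=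
      ⟨trivial, by change 1 < _; omega, by change υ.reg x + 1 < _; omega⟩
    exact assign (j + 1) hs (by simp [hx]) hυ

end WP

/-! ### Digit expansions and the splitting of sums. -/

open Finset

/-- The numbers `∑ l < k, d l * b ^ l` have the digits `d l` in base `b`. -/
theorem sum_digits_div_mod {b : ℕ} (d : ℕ → ℕ) (hd : ∀ i, d i < b) (k i : ℕ) (hi : i < k) :
    (∑ l ∈ range k, d l * b ^ l) / b ^ i % b = d i := by
  have hb : 0 < b := (Nat.zero_le _).trans_lt (hd 0)
  induction k generalizing d i with
  | zero => omega
  | succ k ih =>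
    have h : ∑ l ∈ range (k + 1), d l * b ^ l
        = d 0 + b * ∑ l ∈ range k, d (l + 1) * b ^ l := by
      rw [sum_range_succ', mul_sum, add_comm]
      congr 1
      · simp
      · exact sum_congr rfl fun l _ => by ring
    rw [h]
    cases i with
    | zero => simp [Nat.mod_eq_of_lt (hd 0)]
    | succ i =>
      rw [pow_succ', ← Nat.div_div_eq_div_mul, Nat.add_mul_div_left _ _ hb,
        Nat.div_eq_of_lt (hd 0), zero_add]
      exact ih (fun l => d (l + 1)) (fun l => hd _) i (by omega)

theorem sum_digits_lt {b : ℕ} (d : ℕ → ℕ) (hd : ∀ i, d i < b) (k : ℕ) :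
    ∑ l ∈ range k, d l * b ^ l < b ^ k := by
  induction k with
  | zero => simp
  | succ k ih =>
    rw [sum_range_succ, pow_succ']
    have := Nat.mul_le_mul_right (b ^ k) (Nat.succ_le_of_lt (hd k))
    rw [Nat.succ_mul] at this
    omega

/-- Greedy choice: the new index takes as much of `m` as its bound allows, the others share the rest
by induction. -/
theorem exists_le_sum_eq {ι : Type*} (s : Finset ι) (u : ι → ℕ) (m : ℕ) (hm : m ≤ ∑ i ∈ s, u i) :
    ∃ v : ι → ℕ, (∀ i, v i ≤ u i) ∧ ∑ i ∈ s, v i = m := by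
  classical
  induction s using Finset.induction_on generalizing m with
  | empty => exact ⟨u, fun _ => le_rfl, by simp at hm ⊢; omega⟩
  | insert a s ha ih =>
    rw [sum_insert ha] at hm
    obtain ⟨v, hv, hs⟩ := ih (m - u a) (by omega)
    refine ⟨Function.update v a (min m (u a)), fun i => ?_, ?_⟩
    · by_cases h : i = a
      · subst h; simp
      · simpa [h] using hv i
    · rw [sum_insert ha, sum_congr rfl (g := v) fun i hi => by
        rw [Function.update_of_ne (by rintro rfl; exact ha hi)], hs]
      simp
      omega

/-! ### The dynamic program over binary levels. -/

/-- The data of a succinct instance, as functions on the natural numbers. -/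
structure Inst where
  /-- number of strings, and of letters -/
  k : ℕ
  /-- length of the strings -/
  L : ℕ
  /-- the bound on the distance -/
  d : ℕ
  /-- number of column types -/
  T : ℕ
  /-- representatives of the column types -/
  f : ℕ → ℕ → ℕ
  /-- multiplicities of the column types -/
  b : ℕ → ℕ

namespace Inst

variable (D : Inst)

/-- Number of binary levels. -/
def J : ℕ := Nat.clog 2 (D.L + D.k + 1)
/-- Number of steps of a level: `k + 1` slots for each column type, and one halving step. -/
def S : ℕ := D.T * (D.k + 1) + 1
/-- Base of the digit expansions that encode the states of the dynamic program. -/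
def B : ℕ := 2 * (D.T * (D.k + 1)) + 3
/-- The number of agreements that are missing to the next power of two, if `L - d` are there. -/
def G : ℕ := 2 ^ D.J + D.d - D.L
/-- The number of positions of type `t`, in units of `2 ^ j`, left for the levels from `j` on. -/
def lev (t j : ℕ) : ℕ := (D.b t + D.k) / 2 ^ j - D.k
/-- The number of letters to be chosen for type `t` in level `j`. -/
def cnt (t j : ℕ) : ℕ := D.lev t j - 2 * D.lev t (j + 1)
/-- The level of step `n`. -/
def level (n : ℕ) : ℕ := n / D.S
/-- The column type treated in step `n`; it is `T` in the halving steps. -/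
def typ (n : ℕ) : ℕ := n % D.S / (D.k + 1)
/-- The slot of step `n`. -/
def slot (n : ℕ) : ℕ := n % D.S - D.typ n * (D.k + 1)
/-- `1` if a letter is chosen in step `n`, and `0` otherwise. -/
def act (n : ℕ) : ℕ := if D.typ n < D.T ∧ D.slot n < D.cnt (D.typ n) (D.level n) then 1 else 0
/-- What is added to the `i`-th digit if in step `n` the letter `e` is chosen. -/
def inc (n e i : ℕ) : ℕ :=
  if D.act n = 1 then (if D.f (D.typ n) i = e then 1 else 0)
  else if D.typ n < D.T then 0 else D.G / 2 ^ D.level n % 2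
/-- What the digits are divided by in step `n`. -/
def md (n : ℕ) : ℕ := if D.typ n < D.T then 1 else 2
/-- The digits of a state. -/
def digit (c i : ℕ) : ℕ := c / D.B ^ i % D.B
/-- The digits of the next state. -/
def newDigit (n c e i : ℕ) : ℕ := min ((D.digit c i + D.inc n e i) / D.md n) (D.B - 1)
/-- The state after step `n`, if the state before it was `c` and the letter `e` is chosen. -/
def step (n c e : ℕ) : ℕ := ∑ i ∈ range D.k, D.newDigit n c e i * D.B ^ i
/-- The number of steps. -/
def total : ℕ := D.J * D.S
/-- The final state shows that all strings are covered. -/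
def Check (c : ℕ) : Prop := ∀ i < D.k, 1 ≤ D.digit c i + D.G / 2 ^ D.J

/-- From the state `c` before step `n` one can reach a good final state. -/
inductive Feas : ℕ → ℕ → Prop
  | last {c : ℕ} : D.Check c → Feas D.total c
  | cons {n c e : ℕ} : n < D.total → e < D.k → Feas (n + 1) (D.step n c e) → Feas n c

/-- The laws of succinct instances. -/
structure Ok : Prop where
  k_pos : 1 ≤ D.k
  T_pos : 1 ≤ D.T
  L_pos : 1 ≤ D.L
  f_lt : ∀ t < D.T, ∀ i < D.k, D.f t i < D.k
  b_le : ∀ t < D.T, D.b t ≤ D.L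

/-- The table `x` is a solution. -/
structure Sol (x : ℕ → ℕ → ℕ) : Prop where
  sum : ∀ t < D.T, ∑ e ∈ range D.k, x t e = D.b t
  cover : ∀ i < D.k, D.L ≤ D.d + ∑ t ∈ range D.T, x t (D.f t i)

/-- The table after step `n`. -/
def record (n e : ℕ) (x : ℕ → ℕ → ℕ) : ℕ → ℕ → ℕ := fun t e' =>
  x t e' + if t = D.typ n ∧ e' = e then D.act n * 2 ^ D.level n else 0

/-- The state `c` before step `n` belongs to the table `x` of the letters chosen so far. -/
structure Sem (n c : ℕ) (x : ℕ → ℕ → ℕ) : Prop where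
  sum : ∀ t < D.T, ∑ e ∈ range D.k, x t e + 2 ^ D.level n * D.lev t (D.level n) =
    D.b t + 2 ^ D.level n * min (D.cnt t (D.level n)) (n % D.S - t * (D.k + 1))
  dig : ∀ i < D.k, D.digit c i =
    (∑ t ∈ range D.T, x t (D.f t i) + D.G % 2 ^ D.level n) / 2 ^ D.level n
  bound : ∀ i < D.k, D.digit c i ≤ D.T * (D.k + 1) + 1 + n % D.S

/-- The table `x` before step `n` can be completed to the table `y`. -/
def Rem (n : ℕ) (x y : ℕ → ℕ → ℕ) : Prop :=
  ∃ r y' : ℕ → ℕ → ℕ, ∀ t < D.T, (∀ e < D.k, x t e + 2 ^ D.level n * r t e = y t e) ∧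
    (∀ e < D.k, 2 * y' t e ≤ r t e) ∧
    ∑ e ∈ range D.k, y' t e = D.lev t (D.level n + 1) ∧
    ∑ e ∈ range D.k, r t e + min (D.cnt t (D.level n)) (n % D.S - t * (D.k + 1))
      = D.lev t (D.level n)

variable {D}

/-! ### Arithmetic of levels, types and slots. -/

theorem B_pos : 0 < D.B := by simp [B]
theorem S_pos : 0 < D.S := by simp [S]

theorem newDigit_lt (n c e i : ℕ) : D.newDigit n c e i < D.B :=
  (min_le_right _ _).trans_lt (Nat.sub_one_lt B_pos.ne')

theorem digit_step (n c e : ℕ) {i : ℕ} (hi : i < D.k) :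
    D.digit (D.step n c e) i = D.newDigit n c e i :=
  sum_digits_div_mod _ (newDigit_lt n c e) _ _ hi

theorem step_lt (n c e : ℕ) : D.step n c e < D.B ^ D.k := sum_digits_lt _ (newDigit_lt n c e) _

/-- With $q=\lfloor (b^t+k)/2^j\rfloor$ the two numbers are $q-k$ and $\lfloor q/2\rfloor-k$,
truncated at $0$. The shift by $k$ turns the recursion $r\mapsto\lfloor (r-k)/2\rfloor$ into plain
halving. The gap `k` is what rounding costs in `exists_half`. -/
theorem two_mul_lev_succ (t j : ℕ) :
    D.lev t (j + 1) = 0 ∨ 2 * D.lev t (j + 1) + D.k ≤ D.lev t j := by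
  unfold lev
  rw [pow_succ, ← Nat.div_div_eq_div_mul]
  omega

theorem cnt_add (t j : ℕ) : D.cnt t j + 2 * D.lev t (j + 1) = D.lev t j := by
  have := two_mul_lev_succ (D := D) t j
  unfold cnt
  omega

/-- If the next level is not empty, the count is $k$ plus the parity of $q=\lfloor
(b^t+k)/2^j\rfloor$; otherwise $q\le 2k+1$ and the count is at most $q-k$. Hence $k+1$ slots per
type suffice. -/
theorem cnt_le (t j : ℕ) : D.cnt t j ≤ D.k + 1 := by
  unfold cnt lev
  rw [pow_succ, ← Nat.div_div_eq_div_mul]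
  omega

theorem lev_zero (t : ℕ) : D.lev t 0 = D.b t := by simp [lev]

theorem lt_two_pow_J : D.L + D.k < 2 ^ D.J := Nat.le_pow_clog (by norm_num) (D.L + D.k + 1)

theorem lev_J (h : D.Ok) {t : ℕ} (ht : t < D.T) {j : ℕ} (hj : D.J ≤ j) : D.lev t j = 0 := by
  have := h.b_le t ht
  have h2 := lt_two_pow_J (D := D)
  have h3 := Nat.pow_le_pow_right (n := 2) (by norm_num) hj
  rw [lev, Nat.div_eq_of_lt (by omega), Nat.zero_sub]

theorem typ_le (n : ℕ) : D.typ n ≤ D.T := by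
  rw [typ, ← Nat.lt_succ_iff, Nat.div_lt_iff_lt_mul (by omega)]
  have := Nat.mod_lt n (D.S_pos)
  unfold S at this ⊢
  rw [Nat.succ_mul]
  omega

theorem slot_lt (n : ℕ) : D.slot n < D.k + 1 := by
  have h := Nat.div_add_mod' (n % D.S) (D.k + 1)
  have h2 : n % D.S % (D.k + 1) < D.k + 1 := Nat.mod_lt _ (Nat.succ_pos D.k)
  unfold slot typ
  omega

theorem mod_eq (n : ℕ) : n % D.S = D.typ n * (D.k + 1) + D.slot n := by
  have h := Nat.div_mul_le_self (n % D.S) (D.k + 1)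
  unfold slot typ
  omega

theorem succ_of_lt {n : ℕ} (h : D.typ n < D.T) :
    D.level (n + 1) = D.level n ∧ (n + 1) % D.S = n % D.S + 1 := by
  have h1 := mod_eq (D := D) n
  have h2 := slot_lt (D := D) n
  have h3 : (D.typ n + 1) * (D.k + 1) ≤ D.T * (D.k + 1) := Nat.mul_le_mul_right _ h
  rw [Nat.succ_mul] at h3
  have h4 : n % D.S + 1 < D.S := by unfold S at *; omega
  have h5 := Nat.div_add_mod n D.S
  unfold level
  exact (Nat.div_mod_unique S_pos).2 ⟨by omega, h4⟩

theorem succ_of_eq {n : ℕ} (h : D.typ n = D.T) :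
    D.level (n + 1) = D.level n + 1 ∧ (n + 1) % D.S = 0 := by
  have h1 := mod_eq (D := D) n
  have h2 := Nat.mod_lt n (D.S_pos)
  rw [h] at h1
  have h5 := Nat.div_add_mod n D.S
  unfold level
  refine (Nat.div_mod_unique S_pos).2 ⟨?_, S_pos⟩
  rw [mul_add]
  unfold S at *
  omega

theorem act_le (n : ℕ) : D.act n ≤ 1 := by unfold act; split <;> omega

/-- The minimum is the number of letters already chosen for `t` in this level: the slots of `t`
begin at `t * (k + 1)` and only the first `cnt` of them are active. Truncation gives `0` for types
not yet reached, and `cnt_le` saturates those already passed. -/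
theorem min_cnt_succ {n t : ℕ} (h : D.typ n < D.T) :
    min (D.cnt t (D.level n)) ((n + 1) % D.S - t * (D.k + 1)) =
      min (D.cnt t (D.level n)) (n % D.S - t * (D.k + 1)) + if t = D.typ n then D.act n else 0 := by
  have h1 := mod_eq (D := D) n
  have h2 := slot_lt (D := D) n
  rw [(succ_of_lt h).2, h1]
  have h3 := cnt_le (D := D) t (D.level n)
  rcases lt_trichotomy t (D.typ n) with ht | ht | ht
  · have := Nat.mul_le_mul_right (D.k + 1) ht
    rw [Nat.succ_mul] at this
    rw [if_neg ht.ne, min_eq_left (by omega), min_eq_left (by omega), add_zero]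
  · subst ht
    simp only [if_true, act, h, true_and]
    split <;> omega
  · have := Nat.mul_le_mul_right (D.k + 1) ht
    rw [Nat.succ_mul] at this
    rw [if_neg ht.ne', min_eq_right (by omega), min_eq_right (by omega)]
    omega

theorem min_cnt_eq {n t : ℕ} (h : D.typ n = D.T) (ht : t < D.T) :
    min (D.cnt t (D.level n)) (n % D.S - t * (D.k + 1)) = D.cnt t (D.level n) := by
  have h3 := cnt_le (D := D) t (D.level n)
  have h1 := mod_eq (D := D) n
  have := Nat.mul_le_mul_right (D.k + 1) ht
  rw [Nat.succ_mul] at this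
  rw [h] at h1
  exact min_eq_left (by omega)

/-! ### Soundness: states reached by the dynamic program belong to tables. -/

theorem record_of_eq {n : ℕ} (h : D.typ n = D.T) (e : ℕ) (x : ℕ → ℕ → ℕ) :
    D.record n e x = x := by
  ext t e'
  simp [record, act, h]

theorem sum_record (n : ℕ) {e : ℕ} (he : e < D.k) (x : ℕ → ℕ → ℕ) (t : ℕ) :
    ∑ e' ∈ range D.k, D.record n e x t e' =
      ∑ e' ∈ range D.k, x t e' + if t = D.typ n then D.act n * 2 ^ D.level n else 0 := by
  simp only [record, sum_add_distrib]
  congr 1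
  by_cases h : t = D.typ n <;> simp [h, he]

theorem sum_record_f {n : ℕ} (h : D.typ n < D.T) (e : ℕ) (x : ℕ → ℕ → ℕ) (i : ℕ) :
    ∑ t ∈ range D.T, D.record n e x t (D.f t i) =
      ∑ t ∈ range D.T, x t (D.f t i) + 2 ^ D.level n * D.inc n e i := by
  simp only [record, sum_add_distrib]
  congr 1
  have : ∀ t, (if t = D.typ n ∧ D.f t i = e then D.act n * 2 ^ D.level n else 0)
      = if t = D.typ n then 2 ^ D.level n * D.inc n e i else 0 := by
    intro t
    by_cases ht : t = D.typ n
    · subst ht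
      have := act_le (D := D) n
      rcases (by omega : D.act n = 0 ∨ D.act n = 1) with h0 | h0 <;>
        by_cases hf : D.f (D.typ n) i = e <;> simp [inc, h0, h, hf]
    · simp [ht]
  simp [this, h]

/-- Within a level, a letter adds $2^j$ agreements, hence $1$ to the carry of each string that it
matches. In the halving step nested floors combine, and the bit of `G` extends $G \bmod 2^j$ to $G
\bmod 2^{j+1}$. The cap `B - 1` in `newDigit` never acts here; it only keeps arbitrary states in
range. -/
theorem Sem.next {n c e : ℕ} {x : ℕ → ℕ → ℕ} (h : D.Sem n c x) (he : e < D.k) :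
    D.Sem (n + 1) (D.step n c e) (D.record n e x) := by
  have hB : D.B - 1 = 2 * (D.T * (D.k + 1)) + 2 := by unfold B; omega
  have hm := mod_eq (D := D) n
  have hpos : 0 < 2 ^ D.level n := by positivity
  rcases (typ_le (D := D) n).lt_or_eq with ht | ht
  · obtain ⟨hl, hs⟩ := succ_of_lt ht
    have hsS := Nat.mod_lt (n + 1) D.S_pos
    have hinc : ∀ i, D.inc n e i ≤ 1 := fun i => by
      unfold inc
      simp only [ht, if_true]
      split_ifs <;> omega
    have hnew : ∀ i < D.k, D.newDigit n c e i = D.digit c i + D.inc n e i := fun i hi => by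
      have := h.bound i hi
      have := hinc i
      have hS : D.S = D.T * (D.k + 1) + 1 := rfl
      simp only [newDigit, md, ht, if_true, Nat.div_one]
      exact min_eq_left (by omega)
    refine ⟨fun t htT => ?_, fun i hi => ?_, fun i hi => ?_⟩
    · have := h.sum t htT
      rw [hl, min_cnt_succ ht, sum_record n he]
      split_ifs with h1
      · rw [mul_add, mul_comm (D.act n)]
        omega
      · exact this
    · rw [digit_step _ _ _ hi, hnew i hi, hl, sum_record_f ht, h.dig i hi, add_right_comm,
        Nat.add_mul_div_left _ _ hpos]
    · rw [digit_step _ _ _ hi, hnew i hi, hs]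
      have := h.bound i hi
      have := hinc i
      omega
  · obtain ⟨hl, hs⟩ := succ_of_eq ht
    have hslot : D.slot n = 0 := by
      have := Nat.mod_lt n D.S_pos
      have hS : D.S = D.T * (D.k + 1) + 1 := rfl
      rw [ht] at hm
      omega
    rw [ht, hslot] at hm
    have hinc : ∀ i, D.inc n e i = D.G / 2 ^ D.level n % 2 := fun i => by
      simp [inc, act, ht]
    -- Here `n % S = T * (k + 1)`, so a digit is at most $2T(k+1)+1$, and at most `B - 1` with the
    -- bit of `G`. Halving restores the bound $T(k+1)+1$ for the start of a level.
    have hnew : ∀ i < D.k, D.newDigit n c e i = (D.digit c i + D.G / 2 ^ D.level n % 2) / 2 :=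
      fun i hi => by
        have := h.bound i hi
        simp only [newDigit, md, ht, lt_irrefl, if_false, hinc]
        exact min_eq_left (by omega)
    rw [record_of_eq ht]
    refine ⟨fun t htT => ?_, fun i hi => ?_, fun i hi => ?_⟩
    · have h1 := h.sum t htT
      rw [min_cnt_eq ht htT] at h1
      have h2 := cnt_add (D := D) t (D.level n)
      rw [hl, hs, Nat.zero_sub, Nat.min_zero, mul_zero, pow_succ]
      rw [← h2] at h1
      linarith
    · rw [digit_step _ _ _ hi, hnew i hi, hl, h.dig i hi, pow_succ, Nat.mod_mul,
        ← Nat.div_div_eq_div_mul, ← add_assoc, Nat.add_mul_div_left _ _ hpos]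
    · rw [digit_step _ _ _ hi, hnew i hi, hs]
      have := h.bound i hi
      omega

theorem Sem.zero : D.Sem 0 0 fun _ _ => 0 := by
  refine ⟨fun t _ => ?_, fun i _ => ?_, fun i _ => ?_⟩
  · simp [level, lev_zero]
  · simp [level, digit, Nat.mod_one]
  · simp [digit]

theorem level_total : D.level D.total = D.J := Nat.mul_div_cancel _ S_pos

theorem total_mod : D.total % D.S = 0 := Nat.mul_mod_left _ _

/-- The last carry plus $\lfloor G/2^J\rfloor$ is the floor of (agreements $+\,G)/2^J$, which is
positive exactly if there are at least $L-d$ agreements. The subtraction in `G` does not truncate,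
since $L<2^J$. -/
theorem check_iff {c : ℕ} {x : ℕ → ℕ → ℕ} (h : D.Sem D.total c x) :
    D.Check c ↔ ∀ i < D.k, D.L ≤ D.d + ∑ t ∈ range D.T, x t (D.f t i) := by
  refine forall₂_congr fun i hi => ?_
  rw [h.dig i hi, level_total]
  have h1 := lt_two_pow_J (D := D)
  have h2 : D.G = 2 ^ D.J + D.d - D.L := rfl
  rw [← Nat.add_mul_div_left _ _ (by positivity : 0 < 2 ^ D.J), add_assoc, Nat.mod_add_div,
    Nat.one_le_div_iff (by positivity)]
  omega

theorem Sem.sol (hD : D.Ok) {c : ℕ} {x : ℕ → ℕ → ℕ} (h : D.Sem D.total c x) (hc : D.Check c) :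
    D.Sol x := by
  refine ⟨fun t ht => ?_, (check_iff h).1 hc⟩
  have := h.sum t ht
  rw [level_total, total_mod, lev_J hD ht le_rfl] at this
  simpa using this

/-! ### Completeness: every solution is followed by some path of states. -/

/-- The halves $\lfloor r_e/2\rfloor$ lose at most one unit of $r_e$ per letter, so twice their sum
is at least `lev t j - k`. By `two_mul_lev_succ` this leaves room for the required sum. -/
theorem exists_half (t j : ℕ) (r : ℕ → ℕ) (hr : ∑ e ∈ range D.k, r e = D.lev t j) :
    ∃ y : ℕ → ℕ, (∀ e, 2 * y e ≤ r e) ∧ ∑ e ∈ range D.k, y e = D.lev t (j + 1) := by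
  obtain ⟨y, hy, hs⟩ := exists_le_sum_eq (range D.k) (fun e => r e / 2) (D.lev t (j + 1)) (by
    have h : ∑ e ∈ range D.k, r e ≤ ∑ e ∈ range D.k, (2 * (r e / 2) + 1) :=
      sum_le_sum fun e _ => by omega
    rw [sum_add_distrib, ← mul_sum, hr] at h
    have := two_mul_lev_succ (D := D) t j
    simp at h
    omega)
  exact ⟨y, fun e => by have := hy e; omega, hs⟩

theorem Rem.zero {y : ℕ → ℕ → ℕ} (hy : ∀ t < D.T, ∑ e ∈ range D.k, y t e = D.b t) :
    D.Rem 0 (fun _ _ => 0) y := by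
  have : ∀ t, ∃ z : ℕ → ℕ, t < D.T → (∀ e, 2 * z e ≤ y t e) ∧
      ∑ e ∈ range D.k, z e = D.lev t 1 := fun t => by
    by_cases ht : t < D.T
    · obtain ⟨z, hz⟩ := exists_half t 0 (y t) ((hy t ht).trans (lev_zero t).symm)
      exact ⟨z, fun _ => hz⟩
    · exact ⟨fun _ => 0, fun h => absurd h ht⟩
  choose z hz using this
  refine ⟨y, z, fun t ht => ⟨by simp [level], fun e _ => (hz t ht).1 e, ?_, ?_⟩⟩
  · simpa [level] using (hz t ht).2
  · simpa [level, lev_zero] using hy t ht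

/-- The part $y'$ for the higher levels is fixed when a level begins. While a letter is due, $\sum
r$ exceeds $\sum 2y'$, so some letter has $2y'_e<r_e$ and can be spent. At the halving step the sums
agree, which forces $r=2y'$, and $y'$ becomes the new remainder. -/
theorem Rem.next (hD : D.Ok) {n : ℕ} {x y : ℕ → ℕ → ℕ} (h : D.Rem n x y) :
    ∃ e < D.k, D.Rem (n + 1) (D.record n e x) y := by
  obtain ⟨r, y', h⟩ := h
  rcases (typ_le (D := D) n).lt_or_eq with ht | ht
  · obtain ⟨hl, hs⟩ := succ_of_lt ht
    by_cases ha : D.act n = 1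
    · have hex : ∃ e < D.k, 2 * y' (D.typ n) e < r (D.typ n) e := by
        by_contra! hcon
        obtain ⟨-, -, h3, h4⟩ := h _ ht
        have hle : ∑ e ∈ range D.k, r (D.typ n) e ≤ ∑ e ∈ range D.k, 2 * y' (D.typ n) e :=
          sum_le_sum fun e he => hcon e (mem_range.1 he)
        rw [← mul_sum, h3] at hle
        have h5 := cnt_add (D := D) (D.typ n) (D.level n)
        have h6 : D.slot n < D.cnt (D.typ n) (D.level n) := by
          unfold act at ha
          split_ifs at ha with h7
          exact h7.2
        unfold slot at h6
        omega
      obtain ⟨e, he, hlt⟩ := hex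
      refine ⟨e, he, fun t e' => r t e' - if t = D.typ n ∧ e' = e then 1 else 0, y',
        fun t htT => ?_⟩
      obtain ⟨h1, h2, h3, h4⟩ := h t htT
      rw [hl, min_cnt_succ ht]
      refine ⟨fun e' he' => ?_, fun e' he' => ?_, h3, ?_⟩
      · rw [record, ← h1 e' he']
        by_cases hc : t = D.typ n ∧ e' = e
        · obtain ⟨rfl, rfl⟩ := hc
          obtain ⟨q, hq⟩ : ∃ q, r (D.typ n) e' = q + 1 :=
            ⟨r (D.typ n) e' - 1, by omega⟩
          simp only [hq, ha, and_self, if_true, Nat.add_sub_cancel]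
          ring
        · simp [hc]
      · have := h2 e' he'
        dsimp only
        split_ifs with hc
        · obtain ⟨rfl, rfl⟩ := hc
          omega
        · omega
      · rw [← h4]
        dsimp only
        split_ifs with hc
        · subst hc
          have : ∑ e' ∈ range D.k, r (D.typ n) e' =
              ∑ e' ∈ range D.k, (r (D.typ n) e' - if D.typ n = D.typ n ∧ e' = e then 1 else 0)
                + 1 := by
            rw [← sum_erase_add _ _ (mem_range.2 he), ← sum_erase_add (range D.k)
              (fun e' => r (D.typ n) e' - _) (mem_range.2 he), add_assoc]
            congr 1
            · refine sum_congr rfl fun e' he' => ?_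
              simp [(mem_erase.1 he').1]
            · simp
              omega
          rw [this, ha]
          omega
        · simp [hc]
    · have ha0 : D.act n = 0 := by have := act_le (D := D) n; omega
      -- In an idle slot the letter has no effect, so any letter will do.
      refine ⟨0, hD.k_pos, r, y', fun t htT => ?_⟩
      rw [hl, min_cnt_succ ht, ha0]
      simpa [record, ha0] using h t htT
  · obtain ⟨hl, hs⟩ := succ_of_eq ht
    have hr : ∀ t < D.T, ∀ e < D.k, r t e = 2 * y' t e := by
      intro t htT e he
      obtain ⟨h1, h2, h3, h4⟩ := h t htT
      rw [min_cnt_eq ht htT, ← cnt_add t, ← h3, mul_sum] at h4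
      have h5 : ∑ e ∈ range D.k, 2 * y' t e = ∑ e ∈ range D.k, r t e := by omega
      exact ((sum_eq_sum_iff_of_le fun e he => h2 e (mem_range.1 he)).1 h5 e
        (mem_range.2 he)).symm
    have : ∀ t, ∃ z : ℕ → ℕ, t < D.T → (∀ e, 2 * z e ≤ y' t e) ∧
        ∑ e ∈ range D.k, z e = D.lev t (D.level n + 1 + 1) := fun t => by
      by_cases htT : t < D.T
      · obtain ⟨z, hz⟩ := exists_half t (D.level n + 1) (y' t) (h t htT).2.2.1
        exact ⟨z, fun _ => hz⟩
      · exact ⟨fun _ => 0, fun h => absurd h htT⟩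
    choose z hz using this
    refine ⟨0, hD.k_pos, y', z, fun t htT => ?_⟩
    obtain ⟨h1, h2, h3, h4⟩ := h t htT
    rw [hl, hs, record_of_eq ht, Nat.zero_sub, Nat.min_zero, add_zero]
    refine ⟨fun e he => ?_, fun e _ => (hz t htT).1 e, (hz t htT).2, h3⟩
    rw [← h1 e he, hr t htT e he, pow_succ, mul_assoc]

theorem feas_of_rem (hD : D.Ok) {y : ℕ → ℕ → ℕ} (hy : D.Sol y) (m : ℕ) :
    ∀ n c x, n + m = D.total → D.Sem n c x → D.Rem n x y → D.Feas n c := by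
  induction m with
  | zero =>
    intro n c x hn hs hr
    obtain rfl : n = D.total := hn
    refine .last ((check_iff hs).2 fun i hi => ?_)
    obtain ⟨r, y', h⟩ := hr
    convert hy.cover i hi using 2
    refine sum_congr rfl fun t ht => ?_
    obtain ⟨h1, -, -, h4⟩ := h t (mem_range.1 ht)
    -- Nothing is left at level `J`, so the remainder vanishes and `x` agrees with `y`.
    rw [level_total, lev_J hD (mem_range.1 ht) le_rfl] at h4
    have h0 := (sum_eq_zero_iff.1 (Nat.eq_zero_of_add_eq_zero_right h4))
    have hf := hD.f_lt t (mem_range.1 ht) i hi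
    rw [← h1 _ hf, h0 _ (mem_range.2 hf), mul_zero, add_zero]
  | succ m ih =>
    intro n c x hn hs hr
    obtain ⟨e, he, hr'⟩ := hr.next hD
    exact .cons (by omega) he (ih _ _ _ (by omega) (hs.next he) hr')

theorem feas_of_sol (hD : D.Ok) {y : ℕ → ℕ → ℕ} (hy : D.Sol y) : D.Feas 0 0 :=
  feas_of_rem hD hy D.total 0 0 _ (zero_add _) Sem.zero (Rem.zero hy.sum)

theorem Feas.check {c : ℕ} (h : D.Feas D.total c) : D.Check c := by
  generalize hn : D.total = n at h
  cases h with
  | last h => exact h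
  | cons h => omega

end Inst

-- Code for one step of the dynamic program, and its correctness.

infixr:60 " ;; " => Prog.seq

namespace Prog

open ClosestString.Expr

/-- Computes `md`, `act`, the type, the power of two and the increment `u` of step `n`. -/
def stepHead : Prog :=
  assign .j (v .n / v .S) ;;
  assign .s (v .n - v .j * v .S) ;;
  assign .pw (get (v .Q + v .j)) ;;
  assign .t (v .s / v .K) ;;
  assign .s (v .s - v .t * v .K) ;;
  cond (v .T - v .t)
    (assign .md 1 ;;
      assign .u 0 ;;
      assign .a (get (4 + v .T * v .k + v .t) + v .k) ;;
      assign .a (v .a / v .pw - v .k - 2 * (v .a / (2 * v .pw) - v .k)) ;;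
      -- By truncation this is `1` if `s < a` and `0` otherwise.
      assign .act (1 - (v .s + 1 - v .a)))
    (assign .md 2 ;;
      assign .act 0 ;;
      assign .u (v .G / v .pw - 2 * (v .G / (2 * v .pw))))

/-- Computes the increment `a` of the digit `i`. -/
def stepInc : Prog :=
  cond (v .act)
    (assign .a (get (4 + v .t * v .k + v .i)) ;;
      -- The sum of both truncated differences vanishes only for equal letters.
      assign .a (1 - ((v .a - v .e) + (v .e - v .a))))
    (assign .a (v .u))

/-- Computes the digit `i` of the next state. -/
def stepDigit : Prog :=
  stepInc ;;
  assign .dig (v .cc - v .cc / v .B * v .B) ;;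
  assign .a ((v .dig + v .a) / v .md) ;;
  -- The minimum with `B - 1`, by truncated subtraction.
  assign .a (v .a - (v .a - (v .B - 1))) ;;
  assign .new (v .new + v .a * v .P) ;;
  assign .P (v .P * v .B) ;;
  assign .cc (v .cc / v .B)

/-- Computes the state `new` after step `n` if the state before it is `c` and `e` is chosen. -/
def step : Prog :=
  stepHead ;;
  assign .cc (v .c) ;;
  assign .P 1 ;;
  assign .new 0 ;;
  forLoop .i (v .k) stepDigit

end Prog

/-- The variables that `Prog.step` changes. -/
def Var.temp : Var → Bool
  | .i | .j | .s | .t | .pw | .act | .md | .u | .a | .cc | .P | .new | .dig => true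
  | _ => false

/-- The variables that are not changed after the initialization. -/
def Var.glob : Var → Bool
  | .k | .L | .d | .T | .K | .S | .B | .N | .G | .J | .X | .Q | .Z | .H | .E => true
  | _ => false

theorem View.set_reg_of_temp (σ : View) {x y : Var} (hx : x.temp = false) (hy : y.temp = true)
    (v : ℕ) : (σ.set y v).reg x = σ.reg x := if_neg (by rintro rfl; simp_all)

theorem Var.temp_of_glob {x : Var} (h : x.glob = true) : x.temp = false := by
  cases x <;> simp_all [Var.glob, Var.temp]

namespace Inst

variable (D : Inst)

/-- Where the table of the letters chosen so far is kept. -/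
def X : ℕ := 4 + D.T * D.k + D.T
/-- Where the powers of two are kept. -/
def Q : ℕ := D.X + D.T * D.k
/-- Where the table of the dynamic program is kept. -/
def Z : ℕ := D.Q + D.J + 1
/-- The number of states. -/
def N : ℕ := D.B ^ D.k

/-- The global variables have their final values. -/
structure Glob (σ : View) : Prop where
  k : σ.reg .k = D.k
  L : σ.reg .L = D.L
  d : σ.reg .d = D.d
  T : σ.reg .T = D.T
  K : σ.reg .K = D.k + 1
  S : σ.reg .S = D.S
  B : σ.reg .B = D.B
  N : σ.reg .N = D.N
  G : σ.reg .G = D.G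
  J : σ.reg .J = D.J
  X : σ.reg .X = D.X
  Q : σ.reg .Q = D.Q
  Z : σ.reg .Z = D.Z
  H : σ.reg .H = D.G / 2 ^ D.J
  E : σ.reg .E = D.total

/-- The memory contains the types and their multiplicities. -/
structure Input (mem : ℕ → ℕ) : Prop where
  f : ∀ t < D.T, ∀ i < D.k, mem (4 + t * D.k + i) = D.f t i
  b : ∀ t < D.T, mem (4 + D.T * D.k + t) = D.b t

/-- The memory contains the powers of two. -/
def Powers (mem : ℕ → ℕ) : Prop := ∀ j ≤ D.J, mem (D.Q + j) = 2 ^ j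

/-- Words below `W` are large enough for the program. -/
structure Fits (W : ℕ) : Prop where
  cells : D.Z + (D.total + 1) * D.N < W
  pow : 2 ^ D.J + D.d < W

variable {D}

theorem Glob.congr {σ τ : View} (h : D.Glob σ) (hτ : ∀ x : Var, x.glob → τ.reg x = σ.reg x) :
    D.Glob τ := by
  constructor <;> rw [hτ _ rfl]
  exacts [h.k, h.L, h.d, h.T, h.K, h.S, h.B, h.N, h.G, h.J, h.X, h.Q, h.Z, h.H, h.E]

theorem Glob.set {σ : View} (h : D.Glob σ) {x : Var} (hx : x.glob = false) (a : ℕ) :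
    D.Glob (σ.set x a) :=
  h.congr fun y hy => by
    have : y ≠ x := by rintro rfl; simp_all
    simp [this]

theorem level_lt {n : ℕ} (hn : n < D.total) : D.level n < D.J :=
  (Nat.div_lt_iff_lt_mul S_pos).2 hn

theorem N_pos : 0 < D.N := pow_pos B_pos _

theorem B_le_N (hD : D.Ok) : D.B ≤ D.N := Nat.le_self_pow (by have := hD.k_pos; omega) _

theorem N_lt {W : ℕ} (hF : D.Fits W) : D.N < W := by
  have := hF.cells
  rw [Nat.succ_mul] at this
  omega

theorem Q_le : 4 + D.T * D.k + D.T + D.T * D.k + D.J + 1 ≤ D.Z := le_rfl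

theorem Z_lt {W : ℕ} (hF : D.Fits W) : D.Z < W := by have := hF.cells; omega

theorem two_mul_pow_le {n : ℕ} (hn : n < D.total) : 2 * 2 ^ D.level n ≤ 2 ^ D.J := by
  rw [← pow_succ']
  exact Nat.pow_le_pow_right (by norm_num) (level_lt hn)

theorem G_lt {W : ℕ} (hF : D.Fits W) : D.G < W := by 
  exact (Nat.sub_le _ _).trans_lt hF.pow

/-- After `Prog.stepHead`, the state before it being `σ`. -/
structure Head (n : ℕ) (σ τ : View) : Prop where
  mem : τ.mem = σ.mem
  frame : ∀ x : Var, x.temp = false → τ.reg x = σ.reg x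
  t : τ.reg .t = D.typ n
  act : τ.reg .act = D.act n
  pw : τ.reg .pw = 2 ^ D.level n
  md : τ.reg .md = D.md n
  u : τ.reg .u = if D.typ n < D.T then 0 else D.G / 2 ^ D.level n % 2

theorem stepHead_wp (hD : D.Ok) {W : ℕ} (hF : D.Fits W) {σ : View} (hG : D.Glob σ)
    (hM : D.Input σ.mem) (hP : D.Powers σ.mem) {n : ℕ} (hn : σ.reg .n = n) (hnt : n < D.total) :
    WP W Prog.stepHead 120 (D.Head n σ) σ := by
  have hZ := Z_lt hF
  have hQ := Q_le (D := D)
  have hlev := level_lt hnt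
  have hn1 : n - D.level n * D.S = n % D.S := by
    have := Nat.div_add_mod' n D.S
    unfold level; omega
  have hn2 : D.level n * D.S ≤ n := Nat.div_mul_le_self _ _
  have hn3 : n < W := by
    have h1 := hF.cells
    have h2 : D.total * 1 ≤ (D.total + 1) * D.N := Nat.mul_le_mul (by omega) N_pos
    omega
  have hm := mod_eq (D := D) n
  have hs := slot_lt (D := D) n
  have htl := typ_le (D := D) n
  have hm1 := Nat.mod_le n D.S
  have hpw := two_mul_pow_le hnt
  have hpow := hF.pow
  have hGW := G_lt hF
  have hL := lt_two_pow_J (D := D)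
  -- The step count is a metavariable that the rules fill in; the second goal compares the result
  -- with the stated bound.
  apply WP.mono (R := D.Head n σ)
  · apply WP.seq
    refine WP.assign (D.level n) (by simp) (by simp [hn, hG.S, level]) ?_
    apply WP.seq
    refine WP.assign (n % D.S) (by simp [hG.S]; omega) (by simp [hn, hG.S, hn1]) ?_
    apply WP.seq
    refine WP.assign (2 ^ D.level n) (by simp [hG.Q]; unfold Q X; omega)
      (by simp [hG.Q, hP _ hlev.le]) ?_
    apply WP.seq
    refine WP.assign (D.typ n) (by simp) (by simp [hG.K, typ]) ?_
    apply WP.seq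
    refine WP.assign (D.slot n) (by simp [hG.K]; omega) (by simp [hG.K, slot]) ?_
    apply WP.cond (by simp)
    · intro h
      have ht : D.typ n < D.T := by simpa [hG.T, Nat.sub_eq_zero_iff_le] using h
      have hb := hD.b_le _ ht
      have h2lev : D.lev (D.typ n) (D.level n + 1)
          = (D.b (D.typ n) + D.k) / (2 * 2 ^ D.level n) - D.k := by
        rw [lev, pow_succ']
      have h3lev := two_mul_lev_succ (D := D) (D.typ n) (D.level n)
      have h4lev : D.lev (D.typ n) (D.level n) ≤ D.b (D.typ n) := by
        have := Nat.div_le_self (D.b (D.typ n) + D.k) (2 ^ D.level n)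
        unfold lev; omega
      apply WP.seq
      refine WP.assign 1 (by simp; omega) (by simp) ?_
      apply WP.seq
      refine WP.assign 0 (by simp; omega) (by simp) ?_
      apply WP.seq
      refine WP.assign (D.b (D.typ n) + D.k) (by simp [hG.T, hG.k, hM.b _ ht]; omega)
        (by simp [hG.T, hG.k, hM.b _ ht]) ?_
      apply WP.seq
      refine WP.assign (D.cnt (D.typ n) (D.level n))
        (by simp [hG.k, ← h2lev]; omega) (by simp [hG.k, ← h2lev]; rfl) ?_
      refine WP.assign (D.act n) (by simp; omega) (by simp [act, ht]; split_ifs <;> omega) ?_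
      refine ⟨rfl, fun x hx => ?_, by simp, by simp, by simp, by simp [md, ht], by simp [ht]⟩
      repeat rw [View.set_reg_of_temp _ hx rfl]
    · intro h
      have ht : ¬ D.typ n < D.T := by simpa [hG.T, Nat.sub_eq_zero_iff_le] using h
      have h2 : D.G / 2 ^ D.level n % 2
          = D.G / 2 ^ D.level n - 2 * (D.G / (2 * 2 ^ D.level n)) := by
        rw [mul_comm 2 (2 ^ D.level n), ← Nat.div_div_eq_div_mul]
        omega
      have h3 : 2 * (D.G / (2 * 2 ^ D.level n)) ≤ D.G := by
        rw [← Nat.div_div_eq_div_mul]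
        have := Nat.div_le_self (D.G / 2) (2 ^ D.level n)
        omega
      apply WP.seq
      refine WP.assign 2 (by simp; omega) (by simp) ?_
      apply WP.seq
      refine WP.assign 0 (by simp; omega) (by simp) ?_
      refine WP.assign (D.G / 2 ^ D.level n % 2) (by simp [hG.G]; omega) (by simp [hG.G, h2]) ?_
      refine ⟨rfl, fun x hx => ?_, by simp, by simp [act, ht], by simp, by simp [md, ht],
        by simp [ht]⟩
      repeat rw [View.set_reg_of_temp _ hx rfl]
  · simp
  · exact fun _ h => h

/-- After `i` rounds of the loop in `Prog.step`, the state before `Prog.step` being `σ`. -/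
structure Digits (n c e : ℕ) (σ : View) (i : ℕ) (τ : View) : Prop where
  head : D.Head n σ τ
  cc : τ.reg .cc = c / D.B ^ i
  P : τ.reg .P = D.B ^ i
  new : τ.reg .new = ∑ l ∈ range i, D.newDigit n c e l * D.B ^ l
  i : τ.reg .i = i

theorem Head.congr {n : ℕ} {σ τ τ' : View} (h : D.Head n σ τ) (hm : τ'.mem = τ.mem)
    (hx : ∀ x ∉ [Var.i, .a, .cc, .P, .new, .dig], τ'.reg x = τ.reg x) : D.Head n σ τ' := by
  refine ⟨hm.trans h.mem, fun x hx' => ?_, ?_, ?_, ?_, ?_, ?_⟩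
  · rw [hx, h.frame x hx']
    intro hx
    simp only [List.mem_cons, List.not_mem_nil, or_false] at hx
    rcases hx with rfl | rfl | rfl | rfl | rfl | rfl <;> cases hx'
  · rw [hx _ (by simp), h.t]
  · rw [hx _ (by simp), h.act]
  · rw [hx _ (by simp), h.pw]
  · rw [hx _ (by simp), h.md]
  · rw [hx _ (by simp), h.u]

theorem stepInc_wp (hD : D.Ok) {W : ℕ} (hF : D.Fits W) {σ τ : View} (hG : D.Glob σ)
    (hM : D.Input σ.mem) {n c e i : ℕ} (he : σ.reg .e = e) (hek : e < D.k) (hi : i < D.k)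
    (h : D.Digits n c e σ i τ) {R : View → Prop} (hR : R (τ.set .a (D.inc n e i))) :
    WP W Prog.stepInc 40 R τ := by
  have hZ := Z_lt hF
  have hQ := Q_le (D := D)
  have hTk : D.T * 1 ≤ D.T * D.k := Nat.mul_le_mul_left _ hD.k_pos
  have hk := h.head.frame .k rfl
  have he' := h.head.frame .e rfl
  rw [hG.k] at hk
  rw [he] at he'
  have hkN : D.k < W := by
    have : 1 * D.k ≤ D.T * D.k := Nat.mul_le_mul_right _ hD.T_pos
    omega
  apply WP.mono (R := R)
  · apply WP.cond (by simp)
    · intro ha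
      have ha : D.act n = 1 := by
        have := act_le (D := D) n
        simp [h.head.act] at ha
        omega
      have ht : D.typ n < D.T := by
        unfold act at ha
        split_ifs at ha with h1
        exact h1.1
      have hf := hM.f _ ht i hi
      have hflt := hD.f_lt _ ht i hi
      have htk : (D.typ n + 1) * D.k ≤ D.T * D.k := Nat.mul_le_mul_right _ ht
      rw [Nat.succ_mul] at htk
      apply WP.seq
      refine WP.assign (D.f (D.typ n) i) (by simp [h.head.t, hk, h.i]; omega)
        (by simp [h.head.t, hk, h.i, h.head.mem, hf]) ?_
      refine WP.assign (D.inc n e i) (by simp [he']; omega)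
        (by simp [he', inc, ha]; split_ifs <;> omega) ?_
      convert hR using 1
      simp only [View.set]
      congr 1
      ext x
      by_cases hx : x = .a <;> simp [hx]
    · intro ha
      have ha : D.act n = 0 := by simpa [h.head.act] using ha
      exact WP.assign _ (by simp) (by simp [h.head.u, inc, ha]) hR
  · simp
  · exact fun _ h => h

theorem stepDigit_wp (hD : D.Ok) {W : ℕ} (hF : D.Fits W) {σ τ : View} (hG : D.Glob σ)
    (hM : D.Input σ.mem) {n c e i : ℕ} (he : σ.reg .e = e) (hek : e < D.k) (hi : i < D.k)
    (hc : c < D.N) (h : D.Digits n c e σ i τ) :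
    WP W Prog.stepDigit 110
      (fun υ => υ.reg .i = i ∧ D.Digits n c e σ (i + 1) (υ.set .i (i + 1))) τ := by
  have hNW := N_lt hF
  have hB := h.head.frame .B rfl
  rw [hG.B] at hB
  have hBpos := B_pos (D := D)
  have hB3 : 3 ≤ D.B := by unfold B; omega
  have hBN := B_le_N hD
  have hcc : c / D.B ^ i ≤ c := Nat.div_le_self _ _
  have hcB : c / D.B ^ i / D.B * D.B ≤ c / D.B ^ i := Nat.div_mul_le_self _ _
  have hdm := Nat.div_add_mod' (c / D.B ^ i) D.B
  have hdig : c / D.B ^ i - c / D.B ^ i / D.B * D.B = D.digit c i := by unfold digit; omega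
  have hdlt : D.digit c i < D.B := Nat.mod_lt _ B_pos
  have hinc : D.inc n e i ≤ 1 := by unfold inc; split_ifs <;> omega
  -- Partial sums and powers of `B` stay at or below `N`, so nothing overflows.
  have hsum := sum_digits_lt (D.newDigit n c e) (newDigit_lt n c e) (i + 1)
  rw [sum_range_succ] at hsum
  have hpow : D.B ^ (i + 1) ≤ D.N := Nat.pow_le_pow_right hBpos hi
  have hi1 : D.B ^ i * D.B = D.B ^ (i + 1) := (pow_succ _ _).symm
  have hmin : D.newDigit n c e i = (D.digit c i + D.inc n e i) / D.md n -
      ((D.digit c i + D.inc n e i) / D.md n - (D.B - 1)) := by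
    unfold newDigit
    generalize (D.digit c i + D.inc n e i) / D.md n = q
    omega
  apply WP.mono (R := fun υ => υ.reg .i = i ∧ D.Digits n c e σ (i + 1) (υ.set .i (i + 1)))
  · apply WP.seq
    refine stepInc_wp hD hF hG hM he hek hi h ?_
    apply WP.seq
    refine WP.assign (D.digit c i) (by simp [h.cc, hB]; omega)
      (by simp [h.cc, hB, hdig]) ?_
    apply WP.seq
    refine WP.assign ((D.digit c i + D.inc n e i) / D.md n) (by simp; omega)
      (by simp [h.head.md]) ?_
    apply WP.seq
    refine WP.assign (D.newDigit n c e i) (by simp; omega) (by simp [hB, hmin]) ?_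
    apply WP.seq
    refine WP.assign (∑ l ∈ range (i + 1), D.newDigit n c e l * D.B ^ l)
      (by simp [h.P, h.new]; omega) (by simp [h.P, h.new, sum_range_succ]) ?_
    apply WP.seq
    refine WP.assign (D.B ^ (i + 1)) (by simp [h.P, hB]; omega) (by simp [h.P, hB, hi1]) ?_
    refine WP.assign (c / D.B ^ (i + 1)) (by simp) (by simp [h.cc, hB, Nat.div_div_eq_div_mul, hi1]) ?_
    refine ⟨by simp [h.i], ?_, by simp, by simp, by simp, by simp⟩
    exact h.head.congr rfl fun x hx => by simp at hx; simp [hx]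
  · simp
  · exact fun _ h => h

theorem step_wp (hD : D.Ok) {W : ℕ} (hF : D.Fits W) {σ : View} (hG : D.Glob σ)
    (hM : D.Input σ.mem) (hP : D.Powers σ.mem) {n c e : ℕ} (hn : σ.reg .n = n)
    (hnt : n < D.total) (hc : σ.reg .c = c) (hcN : c < D.N) (he : σ.reg .e = e) (hek : e < D.k) :
    WP W Prog.step (130 * D.k + 150)
      (fun τ => D.Head n σ τ ∧ τ.reg .new = D.step n c e) σ := by
  have hZ := Z_lt hF
  have hQ := Q_le (D := D)
  have hkN : D.k < W := by
    have : 1 * D.k ≤ D.T * D.k := Nat.mul_le_mul_right _ hD.T_pos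
    omega
  apply WP.mono (R := fun τ => D.Head n σ τ ∧ τ.reg .new = D.step n c e)
  · apply WP.seq
    refine (stepHead_wp hD hF hG hM hP hn hnt).mono le_rfl fun τ h => ?_
    have hcτ := h.frame .c rfl
    apply WP.seq
    refine WP.assign c (by simp) (by simp [hcτ, hc]) ?_
    apply WP.seq
    refine WP.assign 1 (by simp; omega) (by simp) ?_
    apply WP.seq
    refine WP.assign 0 (by simp; omega) (by simp) ?_
    apply WP.forLoop (D.Digits n c e σ) D.k hkN
    · refine ⟨?_, by simp, by simp, by simp, by simp⟩
      exact h.congr rfl fun x hx => by simp at hx; simp [hx]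
    · exact fun j τ h => ⟨trivial, (h.head.frame .k rfl).trans hG.k, h.i⟩
    · exact fun j τ hj h => stepDigit_wp hD hF hG hM he hek hj hcN h
    · exact fun τ h => ⟨h.head, h.new⟩
  · simp
    omega
  · exact fun _ h => h

end Inst

/-! ### The whole program. -/

namespace Prog

open ClosestString.Expr

/-- Reads the input and sets the global variables. -/
def init : Prog :=
  assign .k (get 0) ;;
  assign .L (get 1) ;;
  assign .d (get 2) ;;
  assign .T (get 3) ;;
  assign .K (v .k + 1) ;;
  assign .S (v .T * v .K + 1) ;;
  assign .B (2 * (v .T * v .K) + 3) ;;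
  assign .X (4 + v .T * v .k + v .T) ;;
  assign .Q (v .X + v .T * v .k) ;;
  assign .pw 1 ;;
  assign .J 0 ;;
  put (v .Q) 1 ;;
  whileLoop (v .L + v .k + 1 - v .pw)
    (assign .pw (v .pw * 2) ;; assign .J (v .J + 1) ;; put (v .Q + v .J) (v .pw)) ;;
  assign .G (v .pw + v .d - v .L) ;;
  assign .H (v .G / v .pw) ;;
  assign .Z (v .Q + v .J + 1) ;;
  assign .E (v .J * v .S) ;;
  assign .N 1 ;;
  forLoop .i (v .k) (assign .N (v .N * v .B))

/-- The address of the cell of the state `c` before step `n`. -/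
def cell : Expr := v .Z + v .n * v .N + v .c

/-- Computes the cell of the final state `c`. -/
def finalCell : Prog :=
  assign .cc (v .c) ;;
  assign .a 1 ;;
  forLoop .i (v .k)
    (assign .dig (v .cc - v .cc / v .B * v .B) ;;
      -- The factor is `0` exactly if the digit and `H` both vanish.
      assign .a (v .a * (1 - (1 - v .dig) * (1 - v .H))) ;;
      assign .cc (v .cc / v .B)) ;;
  put cell (v .a)

/-- Computes the cells of the final states. -/
def finalRow : Prog := assign .n (v .E) ;; forLoop .c (v .N) finalCell

/-- Tries the letter `e` in the state `c` before step `n`. -/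
def tryLetter : Prog :=
  -- Letters are stored shifted by one, so that `0` can mean that no letter works.
  step ;; cond (get (v .Z + (v .n + 1) * v .N + v .new)) (put cell (v .e + 1)) skip

/-- Computes the cell of the state `c` before step `n`. -/
def innerCell : Prog := put cell 0 ;; forLoop .e (v .k) tryLetter

/-- Computes the cells of the states before step `n`. -/
def innerRow : Prog := forLoop .c (v .N) innerCell

/-- Computes the cells of all states that are not final. -/
def innerRows : Prog :=
  assign .n (v .E) ;; whileLoop (v .n) (assign .n (v .n - 1) ;; innerRow)

/-- Takes step `n` with the letter that the cell of the state prescribes. -/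
def move : Prog :=
  assign .e (get cell - 1) ;;
  step ;;
  assign .a (v .X + v .t * v .k + v .e) ;;
  cond (v .act) (put (v .a) (get (v .a) + v .pw)) skip ;;
  assign .c (v .new)

/-- Takes all steps. -/
def moves : Prog := assign .c 0 ;; forLoop .n (v .E) move

/-- Copies the table of chosen letters to the output. -/
def output : Prog :=
  forLoop .i (v .T * v .k) (put (v .i) (get (v .X + v .i))) ;; assign .ans 1

/-- The program that solves Closest String. -/
def main : Prog :=
  init ;; finalRow ;; innerRows ;; cond (get (v .Z)) (moves ;; output) (assign .ans 0)

end Prog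

/-! ### Memory layout and its invariants. -/

namespace Inst

variable (D : Inst)

/-- The memory contains the table `x` of the letters chosen so far. -/
def Acc (x : ℕ → ℕ → ℕ) (mem : ℕ → ℕ) : Prop :=
  ∀ t < D.T, ∀ e < D.k, mem (D.X + t * D.k + e) = x t e

/-- The initialization is done, and the table of the letters chosen so far is `x`. -/
structure Ready (x : ℕ → ℕ → ℕ) (σ : View) : Prop where
  glob : D.Glob σ
  input : D.Input σ.mem
  powers : D.Powers σ.mem
  acc : D.Acc x σ.mem

/-- What is kept of the letters after which a good final state can be reached. -/
structure Cell (n c a : ℕ) : Prop where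
  feas : D.Feas n c ↔ a ≠ 0
  next : n < D.total → a ≠ 0 → a - 1 < D.k ∧ D.Feas (n + 1) (D.step n c (a - 1))

/-- The cells of the states below `c` before step `n` are computed. -/
def Row (n c : ℕ) (mem : ℕ → ℕ) : Prop := ∀ c' < c, D.Cell n c' (mem (D.Z + n * D.N + c'))

/-- The cells of the states before the steps from `n` on are computed. -/
def Rows (n : ℕ) (mem : ℕ → ℕ) : Prop := ∀ n', n ≤ n' → n' ≤ D.total → D.Row n' D.N mem

variable {D}

theorem cell_bound {t e : ℕ} (ht : t < D.T) (he : e < D.k) : t * D.k + e < D.T * D.k := by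
  have : (t + 1) * D.k ≤ D.T * D.k := Nat.mul_le_mul_right _ ht
  rw [Nat.succ_mul] at this
  omega

theorem Ready.congr {x : ℕ → ℕ → ℕ} {σ τ : View} (h : D.Ready x σ) (hm : τ.mem = σ.mem)
    (hτ : ∀ y : Var, y.glob → τ.reg y = σ.reg y) : D.Ready x τ :=
  ⟨h.glob.congr hτ, hm ▸ h.input, hm ▸ h.powers, hm ▸ h.acc⟩

theorem Ready.set {x : ℕ → ℕ → ℕ} {σ : View} (h : D.Ready x σ) {y : Var} (hy : y.glob = false)
    (a : ℕ) : D.Ready x (σ.set y a) := ⟨h.glob.set hy a, h.input, h.powers, h.acc⟩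

theorem Ready.head {x : ℕ → ℕ → ℕ} {σ τ : View} {n : ℕ} (h : D.Ready x σ) (hτ : D.Head n σ τ) :
    D.Ready x τ := h.congr hτ.mem fun _ hy => hτ.frame _ (Var.temp_of_glob hy)

/-- All cells that `Ready` speaks of lie below `Z`, where the table of the dynamic program begins.
-/
theorem Ready.put {x : ℕ → ℕ → ℕ} {σ : View} (h : D.Ready x σ) {a : ℕ} (ha : D.Z ≤ a) (u : ℕ) :
    D.Ready x (σ.put a u) := by
  have hQ := Q_le (D := D)
  refine ⟨h.glob.congr fun _ _ => rfl, ⟨fun t ht i hi => ?_, fun t ht => ?_⟩, fun j hj => ?_,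
    fun t ht e he => ?_⟩
  · have := cell_bound ht hi
    rw [View.put_mem, if_neg (by omega), h.input.f t ht i hi]
  · rw [View.put_mem, if_neg (by omega), h.input.b t ht]
  · have : D.Z = D.Q + D.J + 1 := rfl
    rw [View.put_mem, if_neg (by omega), h.powers j hj]
  · have := cell_bound ht he
    have : D.X = 4 + D.T * D.k + D.T := rfl
    rw [View.put_mem, if_neg (by omega), h.acc t ht e he]

theorem mul_N_add_lt {n n' c c' : ℕ} (h : n < n') (hc : c < D.N) :
    n * D.N + c < n' * D.N + c' := by
  have := Nat.mul_le_mul_right D.N h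
  rw [Nat.succ_mul] at this
  omega

theorem addr_lt {W : ℕ} (hF : D.Fits W) {n c : ℕ} (hn : n ≤ D.total) (hc : c < D.N) :
    D.Z + n * D.N + c < W := by
  have h1 := hF.cells
  have := mul_N_add_lt (c' := 0) (Nat.lt_succ_of_le hn) hc
  simp only [Nat.succ_eq_add_one] at this
  omega

theorem Row.put {n c : ℕ} {σ : View} (h : D.Row n c σ.mem) {a : ℕ} (ha : D.Z + n * D.N + c ≤ a)
    (u : ℕ) : D.Row n c (σ.put a u).mem := fun c' hc' => by
  rw [View.put_mem, if_neg (by omega)]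
  exact h c' hc'

theorem Rows.put {n c : ℕ} {σ : View} (h : D.Rows (n + 1) σ.mem) (hc : c < D.N) (u : ℕ) :
    D.Rows (n + 1) (σ.put (D.Z + n * D.N + c) u).mem := fun n' hn' hn'' c' hc' => by
  have := mul_N_add_lt (c' := c') (Nat.lt_of_succ_le hn') hc
  rw [View.put_mem, if_neg (by omega)]
  exact h n' hn' hn'' c' hc'

theorem total_lt {W : ℕ} (hF : D.Fits W) : D.total + 1 < W := by
  have h1 := hF.cells
  have h2 : (D.total + 1) * 1 ≤ (D.total + 1) * D.N := Nat.mul_le_mul_left _ N_pos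
  have : 1 ≤ D.Z := by unfold Z; omega
  omega

theorem k_lt {W : ℕ} (hD : D.Ok) (hF : D.Fits W) : D.k + 1 < W := by
  have hZ := Z_lt hF
  have hQ := Q_le (D := D)
  have : 1 * D.k ≤ D.T * D.k := Nat.mul_le_mul_right _ hD.T_pos
  omega

/-! ### Correctness of the row of final states. -/

section FinalRow

/-- After `i` rounds of the loop in `Prog.finalCell`, the state before it being `σ`. -/
structure Checks (c : ℕ) (σ : View) (i : ℕ) (τ : View) : Prop where
  mem : τ.mem = σ.mem
  frame : ∀ x : Var, x.temp = false → τ.reg x = σ.reg x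
  cc : τ.reg .cc = c / D.B ^ i
  a : τ.reg .a = 1 ∧ (∀ l < i, 1 ≤ D.digit c l + D.G / 2 ^ D.J) ∨
    τ.reg .a = 0 ∧ ¬ ∀ l < i, 1 ≤ D.digit c l + D.G / 2 ^ D.J
  i : τ.reg .i = i

theorem cell_last {c a : ℕ} (h : a = 1 ∧ D.Check c ∨ a = 0 ∧ ¬ D.Check c) :
    D.Cell D.total c a := by
  refine ⟨?_, fun h => absurd h (lt_irrefl _)⟩
  have : D.Feas D.total c ↔ D.Check c := ⟨Feas.check, .last⟩
  rw [this]
  rcases h with ⟨rfl, h⟩ | ⟨rfl, h⟩ <;> simp [h]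

theorem finalCell_wp (hD : D.Ok) {W : ℕ} (hF : D.Fits W) {x : ℕ → ℕ → ℕ} {σ : View}
    (hR : D.Ready x σ) (hn : σ.reg .n = D.total) {c : ℕ} (hc : σ.reg .c = c) (hcN : c < D.N)
    (hrow : D.Row D.total c σ.mem) :
    WP W Prog.finalCell (60 * D.k + 40) (fun τ => D.Ready x τ ∧ τ.reg .n = D.total ∧ τ.reg .c = c ∧
      D.Row D.total (c + 1) τ.mem) σ := by
  have hk := k_lt hD hF
  have hNW := N_lt hF
  apply WP.mono (R := fun τ => D.Ready x τ ∧ τ.reg .n = D.total ∧ τ.reg .c = c ∧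
      D.Row D.total (c + 1) τ.mem)
  · apply WP.seq
    refine WP.assign c (by simp) (by simp [hc]) ?_
    apply WP.seq
    refine WP.assign 1 (by simp; omega) (by simp) ?_
    apply WP.seq
    apply WP.forLoop (D.Checks c σ) D.k (by omega)
    · refine ⟨by simp, fun y hy => ?_, by simp, by simp, by simp⟩
      repeat rw [View.set_reg_of_temp _ hy rfl]
    · exact fun j τ h => ⟨trivial, (h.frame .k rfl).trans hR.glob.k, h.i⟩
    · intro j τ hj h
      have hB := (h.frame .B rfl).trans hR.glob.B
      have hH := (h.frame .H rfl).trans hR.glob.H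
      have hcc : c / D.B ^ j ≤ c := Nat.div_le_self _ _
      have hcB : c / D.B ^ j / D.B * D.B ≤ c / D.B ^ j := Nat.div_mul_le_self _ _
      have hdm := Nat.div_add_mod' (c / D.B ^ j) D.B
      have hdig : c / D.B ^ j - c / D.B ^ j / D.B * D.B = D.digit c j := by unfold digit; omega
      have ha1 : τ.reg .a ≤ 1 := by rcases h.a with ⟨h, -⟩ | ⟨h, -⟩ <;> omega
      have hle : (1 - D.digit c j) * (1 - D.G / 2 ^ D.J) ≤ 1 * 1 :=
        Nat.mul_le_mul (Nat.sub_le _ _) (Nat.sub_le _ _)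
      have hle' : τ.reg .a * (1 - (1 - D.digit c j) * (1 - D.G / 2 ^ D.J)) ≤ 1 * 1 :=
        Nat.mul_le_mul ha1 (Nat.sub_le _ _)
      apply WP.seq
      refine WP.assign (D.digit c j) (by simp [h.cc, hB]; omega) (by simp [h.cc, hB, hdig]) ?_
      apply WP.seq
      refine WP.assign (τ.reg .a * (1 - (1 - D.digit c j) * (1 - D.G / 2 ^ D.J)))
        (by simp [hH]; omega) (by simp [hH]) ?_
      refine WP.assign (c / D.B ^ (j + 1)) (by simp)
        (by simp [h.cc, hB, Nat.div_div_eq_div_mul, pow_succ]) ?_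
      refine ⟨by simp [h.i], by simp [h.mem], fun y hy => ?_, by simp, ?_, by simp⟩
      · repeat rw [View.set_reg_of_temp _ hy rfl]
        exact h.frame y hy
      · simp only [View.set_reg, reduceCtorEq, if_false, if_true, Nat.forall_lt_succ_right]
        have : (1 - D.digit c j) * (1 - D.G / 2 ^ D.J) =
            if 1 ≤ D.digit c j + D.G / 2 ^ D.J then 0 else 1 := by
          split_ifs with h1
          · rcases Nat.eq_zero_or_pos (D.digit c j) with h0 | h0
            · rw [Nat.sub_eq_zero_of_le (by omega : 1 ≤ D.G / 2 ^ D.J), mul_zero]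
            · rw [Nat.sub_eq_zero_of_le h0, zero_mul]
          · rw [show D.digit c j = 0 by omega, show D.G / 2 ^ D.J = 0 by omega]
        rw [this]
        by_cases h1 : 1 ≤ D.digit c j + D.G / 2 ^ D.J
        · simpa [h1] using h.a
        · simp [h1]
    · intro τ h
      have hc' := (h.frame .c rfl).trans hc
      have hn' := (h.frame .n rfl).trans hn
      have hZ := (h.frame .Z rfl).trans hR.glob.Z
      have hN := (h.frame .N rfl).trans hR.glob.N
      have hlt := addr_lt hF le_rfl hcN
      refine WP.put (D.Z + D.total * D.N + c) (τ.reg .a)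
        (by simp [Prog.cell, hc', hn', hZ, hN]; omega) (by simp)
        (by simp [Prog.cell, hc', hn', hZ, hN]) (by simp) ?_
      refine ⟨(hR.congr h.mem fun y hy => h.frame y (Var.temp_of_glob hy)).put
        (by rw [add_assoc]; exact Nat.le_add_right _ _) _, hn', hc', fun c' hc'' => ?_⟩
      rw [View.put_mem]
      split_ifs with heq
      · obtain rfl : c' = c := by omega
        exact cell_last h.a
      · rw [h.mem]
        exact hrow c' (by omega)
  · simp [Prog.cell]
    omega
  · exact fun _ h => h

theorem finalRow_wp (hD : D.Ok) {W : ℕ} (hF : D.Fits W) {x : ℕ → ℕ → ℕ} {σ : View}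
    (hR : D.Ready x σ) :
    WP W Prog.finalRow (D.N * (60 * D.k + 60) + 20)
      (fun τ => D.Ready x τ ∧ D.Rows D.total τ.mem) σ := by
  apply WP.mono (R := fun τ => D.Ready x τ ∧ D.Rows D.total τ.mem)
  · apply WP.seq
    refine WP.assign D.total (by simp) (by simp [hR.glob.E]) ?_
    apply WP.forLoop (fun c τ => D.Ready x τ ∧ τ.reg .n = D.total ∧ τ.reg .c = c ∧
      D.Row D.total c τ.mem) D.N (N_lt hF)
    · exact ⟨(hR.set rfl _).set rfl _, by simp, by simp, fun c' hc' => by omega⟩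
    · exact fun c τ h => ⟨trivial, h.1.glob.N, h.2.2.1⟩
    · intro c τ hc h
      exact (finalCell_wp hD hF h.1 h.2.1 h.2.2.1 hc h.2.2.2).mono le_rfl fun υ h =>
        ⟨h.2.2.1, h.1.set rfl _, by simp [h.2.1], by simp, h.2.2.2⟩
    · exact fun τ h => ⟨h.1, fun n' h1 h2 => by
        obtain rfl : n' = D.total := by omega
        exact h.2.2.2⟩
  · simp
    have : D.N * (60 * D.k + 40 + 6 + 5 + 1) ≤ D.N * (60 * D.k + 60) :=
      Nat.mul_le_mul_left _ (by omega)
    omega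
  · exact fun _ h => h

end FinalRow

/-! ### Correctness of the backward computation. -/

section InnerRows

/-- After the letters below `e` were tried in the state `c` before step `n`. -/
structure Tried (x : ℕ → ℕ → ℕ) (n c e : ℕ) (σ : View) : Prop where
  ready : D.Ready x σ
  rows : D.Rows (n + 1) σ.mem
  row : D.Row n c σ.mem
  none : σ.mem (D.Z + n * D.N + c) = 0 → ∀ e' < e, ¬ D.Feas (n + 1) (D.step n c e')
  some : σ.mem (D.Z + n * D.N + c) ≠ 0 → σ.mem (D.Z + n * D.N + c) - 1 < D.k ∧
    D.Feas (n + 1) (D.step n c (σ.mem (D.Z + n * D.N + c) - 1))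
  n : σ.reg .n = n
  c : σ.reg .c = c

/-- Once all letters were tried, an empty cell refutes every `Feas.cons`, and `Feas.last` cannot
apply before `total`. -/
theorem Tried.row_succ {x : ℕ → ℕ → ℕ} {n c : ℕ} {σ : View} (h : D.Tried x n c D.k σ)
    (hn : n < D.total) : D.Row n (c + 1) σ.mem := by
  intro c' hc'
  rcases (Nat.lt_succ_iff.1 hc').lt_or_eq with h1 | rfl
  · exact h.row c' h1
  refine ⟨⟨fun hf h0 => ?_, fun h0 => ?_⟩, fun _ => h.some⟩
  · cases hf with
    | last => exact lt_irrefl _ hn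
    | cons _ he hf => exact h.none h0 _ he hf
  · exact .cons hn (h.some h0).1 (h.some h0).2

theorem tryLetter_wp (hD : D.Ok) {W : ℕ} (hF : D.Fits W) {x : ℕ → ℕ → ℕ} {σ : View} {n c e : ℕ}
    (hn : n < D.total) (hc : c < D.N) (hek : e < D.k) (he : σ.reg .e = e)
    (h : D.Tried x n c e σ) :
    WP W Prog.tryLetter (130 * D.k + 190)
      (fun τ => τ.reg .e = e ∧ D.Tried x n c (e + 1) τ) σ := by
  have hk := k_lt hD hF
  apply WP.mono (R := fun τ => τ.reg .e = e ∧ D.Tried x n c (e + 1) τ)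
  · apply WP.seq
    refine (step_wp hD hF h.ready.glob h.ready.input h.ready.powers h.n hn h.c hc he hek).mono
      le_rfl fun τ hτ => ?_
    obtain ⟨hτ, hnew⟩ := hτ
    have hr := h.ready.head hτ
    have hn' := (hτ.frame .n rfl).trans h.n
    have hc' := (hτ.frame .c rfl).trans h.c
    have he' := (hτ.frame .e rfl).trans he
    have hstep : D.step n c e < D.N := step_lt n c e
    have hcell := h.rows (n + 1) le_rfl hn _ hstep
    have haddr := addr_lt hF hn hstep
    have haddr' := addr_lt hF hn.le hc
    have ht := total_lt hF
    have hle : D.Z ≤ D.Z + n * D.N + c := by rw [add_assoc]; exact Nat.le_add_right _ _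
    rw [← hτ.mem] at hcell
    apply WP.cond (by simp [hr.glob.Z, hr.glob.N, hn', hnew]; simp only [Nat.succ_eq_add_one] at *; omega)
    · intro h0
      have h0 : τ.mem (D.Z + (n + 1) * D.N + D.step n c e) ≠ 0 := by
        simpa [hr.glob.Z, hr.glob.N, hn', hnew] using h0
      refine WP.put (D.Z + n * D.N + c) (e + 1)
        (by simp [Prog.cell, hr.glob.Z, hr.glob.N, hn', hc']; omega) (by simp [he']; omega)
        (by simp [Prog.cell, hr.glob.Z, hr.glob.N, hn', hc']) (by simp [he']) ?_
      refine ⟨he', hr.put hle _, ?_, ?_, by simp, fun _ => ?_, hn', hc'⟩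
      · exact Rows.put (hτ.mem ▸ h.rows) hc _
      · exact Row.put (hτ.mem ▸ h.row) le_rfl _
      · simpa using ⟨hek, hcell.feas.2 h0⟩
    · intro h0
      have h0 : τ.mem (D.Z + (n + 1) * D.N + D.step n c e) = 0 := by
        simpa [hr.glob.Z, hr.glob.N, hn', hnew] using h0
      refine WP.skip ⟨he', hr, hτ.mem ▸ h.rows, hτ.mem ▸ h.row, fun h1 e' he'' => ?_,
        hτ.mem ▸ h.some, hn', hc'⟩
      rw [hτ.mem] at h1
      rcases (Nat.lt_succ_iff.1 he'').lt_or_eq with h2 | rfl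
      · exact h.none h1 e' h2
      · exact fun hf => hcell.feas.1 hf h0
  · simp [Prog.cell]
  · exact fun _ h => h

theorem innerCell_wp (hD : D.Ok) {W : ℕ} (hF : D.Fits W) {x : ℕ → ℕ → ℕ} {σ : View} {n c : ℕ}
    (hn : n < D.total) (hc : c < D.N) (hR : D.Ready x σ) (hnr : σ.reg .n = n)
    (hcr : σ.reg .c = c) (hrows : D.Rows (n + 1) σ.mem) (hrow : D.Row n c σ.mem) :
    WP W Prog.innerCell (D.k * (130 * D.k + 210) + 30) (fun τ => D.Ready x τ ∧ τ.reg .n = n ∧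
      τ.reg .c = c ∧ D.Rows (n + 1) τ.mem ∧ D.Row n (c + 1) τ.mem) σ := by
  have hk := k_lt hD hF
  apply WP.mono (R := fun τ => D.Ready x τ ∧ τ.reg .n = n ∧
      τ.reg .c = c ∧ D.Rows (n + 1) τ.mem ∧ D.Row n (c + 1) τ.mem)
  · have haddr' := addr_lt hF hn.le hc
    have hle : D.Z ≤ D.Z + n * D.N + c := by rw [add_assoc]; exact Nat.le_add_right _ _
    apply WP.seq
    refine WP.put (D.Z + n * D.N + c) 0
      (by simp [Prog.cell, hR.glob.Z, hR.glob.N, hnr, hcr]; omega) (by simp; omega)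
      (by simp [Prog.cell, hR.glob.Z, hR.glob.N, hnr, hcr]) (by simp) ?_
    apply WP.forLoop (fun e τ => τ.reg .e = e ∧ D.Tried x n c e τ) D.k (by omega)
    · exact ⟨by simp, (hR.put hle _).set rfl _, hrows.put hc _, hrow.put le_rfl _,
        fun _ e' he' => by omega, by simp, by simp [hnr], by simp [hcr]⟩
    · exact fun e τ h => ⟨trivial, h.2.ready.glob.k, h.1⟩
    · intro e τ he h
      exact (tryLetter_wp hD hF hn hc he h.1 h.2).mono le_rfl fun υ h =>
        ⟨h.1, by simp, h.2.ready.set rfl _, h.2.rows, h.2.row, h.2.none, h.2.some,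
          by simp [h.2.n], by simp [h.2.c]⟩
    · exact fun τ h => ⟨h.2.ready, h.2.n, h.2.c, h.2.rows, h.2.row_succ hn⟩
  · simp [Prog.cell]
    have : D.k * (130 * D.k + 190 + 6 + 5 + 1) ≤ D.k * (130 * D.k + 210) :=
      Nat.mul_le_mul_left _ (by omega)
    omega
  · exact fun _ h => h

theorem innerRow_wp (hD : D.Ok) {W : ℕ} (hF : D.Fits W) {x : ℕ → ℕ → ℕ} {σ : View} {n : ℕ}
    (hn : n < D.total) (hR : D.Ready x σ) (hnr : σ.reg .n = n) (hrows : D.Rows (n + 1) σ.mem) :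
    WP W Prog.innerRow (D.N * (D.k * (130 * D.k + 210) + 50) + 20)
      (fun τ => D.Ready x τ ∧ τ.reg .n = n ∧ D.Rows n τ.mem) σ := by
  apply WP.mono (R := fun τ => D.Ready x τ ∧ τ.reg .n = n ∧ D.Rows n τ.mem)
  · apply WP.forLoop (fun c τ => D.Ready x τ ∧ τ.reg .n = n ∧
      τ.reg .c = c ∧ D.Rows (n + 1) τ.mem ∧ D.Row n c τ.mem) D.N (N_lt hF)
    · exact ⟨hR.set rfl _, by simp [hnr], by simp, hrows, fun c' hc' => by omega⟩
    · exact fun c τ h => ⟨trivial, h.1.glob.N, h.2.2.1⟩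
    · intro c τ hc h
      obtain ⟨h1, h2, h3, h4, h5⟩ := h
      exact (innerCell_wp hD hF hn hc h1 h2 h3 h4 h5).mono le_rfl fun υ h =>
        ⟨h.2.2.1, h.1.set rfl _, by simp [h.2.1], by simp, h.2.2.2.1, h.2.2.2.2⟩
    · refine fun τ h => ⟨h.1, h.2.1, fun n' h1 h2 => ?_⟩
      rcases h1.lt_or_eq with h1 | rfl
      · exact h.2.2.2.1 n' h1 h2
      · exact h.2.2.2.2
  · simp
    have : D.N * (D.k * (130 * D.k + 210) + 30 + 6 + 5 + 1) ≤
        D.N * (D.k * (130 * D.k + 210) + 50) := Nat.mul_le_mul_left _ (by omega)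
    omega
  · exact fun _ h => h

theorem innerRows_wp (hD : D.Ok) {W : ℕ} (hF : D.Fits W) {x : ℕ → ℕ → ℕ} {σ : View}
    (hR : D.Ready x σ) (hrows : D.Rows D.total σ.mem) :
    WP W Prog.innerRows (D.total * (D.N * (D.k * (130 * D.k + 210) + 50) + 60) + 20)
      (fun τ => D.Ready x τ ∧ D.Rows 0 τ.mem) σ := by
  have ht := total_lt hF
  apply WP.mono (R := fun τ => D.Ready x τ ∧ D.Rows 0 τ.mem)
  · apply WP.seq
    refine WP.assign D.total (by simp) (by simp [hR.glob.E]) ?_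
    -- The rows are filled downwards, because the cells of step `n` read those of step `n + 1`.
    apply WP.whileLoop (fun m τ => D.Ready x τ ∧ τ.reg .n = D.total - m ∧
      D.Rows (D.total - m) τ.mem) D.total
    · exact ⟨hR.set rfl _, by simp, hrows⟩
    · intro m τ _ h
      simp [h.2.1, Nat.sub_eq_zero_iff_le]
    · intro m τ hm h
      obtain ⟨h1, h2, h3⟩ := h
      apply WP.seq
      refine WP.assign (D.total - (m + 1)) (by simp; omega) (by simp [h2]; omega) ?_
      refine innerRow_wp hD hF (by omega) (h1.set rfl _) (by simp) ?_
      rwa [show D.total - (m + 1) + 1 = D.total - m by omega]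
    · exact fun τ h => ⟨h.1, by simpa using h.2.2⟩
  · simp
    have : D.total * (6 + (D.N * (D.k * (130 * D.k + 210) + 50) + 20) + 2 + 1) ≤
        D.total * (D.N * (D.k * (130 * D.k + 210) + 50) + 60) := Nat.mul_le_mul_left _ (by omega)
    omega
  · exact fun _ h => h

end InnerRows

end Inst

namespace Inst

variable {D : Inst}

/-! ### Correctness of the replay and of the output. -/

section Moves

theorem Rows.put_of_lt {n : ℕ} {σ : View} (h : D.Rows n σ.mem) {a : ℕ} (ha : a < D.Z) (u : ℕ) :
    D.Rows n (σ.put a u).mem := fun n' hn' hn'' c' hc' => by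
  rw [View.put_mem, if_neg (by rw [add_assoc]; omega)]
  exact h n' hn' hn'' c' hc'

theorem index_inj {t t' e e' : ℕ} (he : e < D.k) (he' : e' < D.k) :
    t * D.k + e = t' * D.k + e' ↔ t = t' ∧ e = e' := by
  refine ⟨fun h => ?_, fun h => by rw [h.1, h.2]⟩
  have hle : ∀ {a b : ℕ}, a < b → a * D.k + D.k ≤ b * D.k := fun {a b} hab => by
    rw [← Nat.succ_mul]
    exact Nat.mul_le_mul_right _ hab
  rcases lt_trichotomy t t' with ht | rfl | ht
  · have := hle ht
    omega
  · exact ⟨rfl, by omega⟩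
  · have := hle ht
    omega

theorem Ready.record {x : ℕ → ℕ → ℕ} {σ : View} (h : D.Ready x σ) {n e : ℕ} (he : e < D.k)
    (ha : D.act n = 1) :
    D.Ready (D.record n e x) (σ.put (D.X + D.typ n * D.k + e)
      (x (D.typ n) e + 2 ^ D.level n)) := by
  have ht : D.typ n < D.T := by
    unfold act at ha
    split_ifs at ha with h1
    exact h1.1
  have hX : D.X = 4 + D.T * D.k + D.T := rfl
  have hQ : D.Q = D.X + D.T * D.k := rfl
  have hlt := cell_bound ht he
  refine ⟨h.glob.congr fun _ _ => rfl, ⟨fun t ht i hi => ?_, fun t ht => ?_⟩, fun j hj => ?_,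
    fun t ht' e' he' => ?_⟩
  · have := cell_bound ht hi
    rw [View.put_mem, if_neg (by omega), h.input.f t ht i hi]
  · rw [View.put_mem, if_neg (by omega), h.input.b t ht]
  · rw [View.put_mem, if_neg (by omega), h.powers j hj]
  · have hiff : D.X + t * D.k + e' = D.X + D.typ n * D.k + e ↔ t = D.typ n ∧ e' = e := by
      rw [add_assoc, add_assoc, Nat.add_left_cancel_iff, index_inj he' he]
    simp only [View.put_mem, hiff, h.acc t ht' e' he', Inst.record, ha, one_mul]
    split_ifs with h1
    · rw [h1.1, h1.2]
    · rfl

/-- The letters chosen in the current level number at most `cnt`, hence at most `lev`, so a partial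
row sum cannot exceed `b t`. This keeps the accumulated words in range. -/
theorem Sem.le {n c : ℕ} {x : ℕ → ℕ → ℕ} (h : D.Sem n c x) {t e : ℕ} (ht : t < D.T)
    (he : e < D.k) : x t e ≤ D.b t := by
  have h1 := h.sum t ht
  have h2 : 2 ^ D.level n * min (D.cnt t (D.level n)) (n % D.S - t * (D.k + 1)) ≤
      2 ^ D.level n * D.lev t (D.level n) :=
    Nat.mul_le_mul_left _ ((min_le_left _ _).trans (Nat.sub_le _ _))
  have h3 := single_le_sum (f := x t) (fun _ _ => Nat.zero_le _) (mem_range.2 he)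
  omega

/-- Before step `n` of `Prog.moves`. -/
def Moved (n : ℕ) (σ : View) : Prop :=
  ∃ x c, D.Ready x σ ∧ D.Rows 0 σ.mem ∧ D.Sem n c x ∧ D.Feas n c ∧ c < D.N ∧
    σ.reg .n = n ∧ σ.reg .c = c

theorem move_wp (hD : D.Ok) {W : ℕ} (hF : D.Fits W) {σ : View} {n : ℕ} (hn : n < D.total)
    (h : D.Moved n σ) :
    WP W Prog.move (130 * D.k + 220)
      (fun τ => τ.reg .n = n ∧ D.Moved (n + 1) (τ.set .n (n + 1))) σ := by
  obtain ⟨x, c, hR, hrows, hsem, hfeas, hcN, hnr, hcr⟩ := h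
  have hk := k_lt hD hF
  have haddr := addr_lt hF hn.le hcN
  have hcell := hrows n (Nat.zero_le _) hn.le c hcN
  obtain ⟨hek, hfeas'⟩ := hcell.next hn (hcell.feas.1 hfeas)
  set e := σ.mem (D.Z + n * D.N + c) - 1 with he
  have hZ := Z_lt hF
  have hQ := Q_le (D := D)
  have hTk : D.T * 1 ≤ D.T * D.k := Nat.mul_le_mul_left _ hD.k_pos
  have hX : D.X = 4 + D.T * D.k + D.T := rfl
  have htk : D.typ n * D.k ≤ D.T * D.k := Nat.mul_le_mul_right _ (typ_le n)
  have hkT : 1 * D.k ≤ D.T * D.k := Nat.mul_le_mul_right _ hD.T_pos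
  have hZN : D.Z + D.N < W := by
    have h1 := hF.cells
    have h2 : 1 * D.N ≤ (D.total + 1) * D.N := Nat.mul_le_mul_right _ (by omega)
    omega
  have hkN : D.k ≤ D.N := by
    have h1 := B_le_N hD
    have h2 : 1 * (D.k + 1) ≤ D.T * (D.k + 1) := Nat.mul_le_mul_right _ hD.T_pos
    unfold B at h1
    omega
  have hR' : D.Ready x (σ.set .e e) := hR.set rfl _
  apply WP.mono (R := fun τ => τ.reg .n = n ∧ D.Moved (n + 1) (τ.set .n (n + 1)))
  · apply WP.seq
    refine WP.assign e (by simp [Prog.cell, hR.glob.Z, hR.glob.N, hnr, hcr]; omega)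
      (by simp [Prog.cell, hR.glob.Z, hR.glob.N, hnr, hcr, he]) ?_
    apply WP.seq
    refine (step_wp (n := n) (c := c) (e := e) hD hF hR'.glob hR'.input hR'.powers (by simp [hnr])
      hn (by simp [hcr]) hcN (by simp) hek).mono le_rfl fun τ hτ => ?_
    obtain ⟨hτ, hnew⟩ := hτ
    have hr := hR'.head hτ
    have hn' : τ.reg .n = n := (hτ.frame .n rfl).trans (by simp [hnr])
    have he' : τ.reg .e = e := (hτ.frame .e rfl).trans (by simp)
    have hrows' : D.Rows 0 τ.mem := by
      rw [hτ.mem]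
      exact hrows
    apply WP.seq
    refine WP.assign (D.X + D.typ n * D.k + e) (by simp [hr.glob.X, hr.glob.k, hτ.t, he']; omega)
      (by simp [hr.glob.X, hr.glob.k, hτ.t, he']) ?_
    have hr := hr.set (y := .a) rfl (D.X + D.typ n * D.k + e)
    apply WP.seq
    apply WP.cond (by simp)
    · intro ha
      have ha : D.act n = 1 := by
        have := act_le (D := D) n
        simp [hτ.act] at ha
        omega
      have ht : D.typ n < D.T := by
        unfold act at ha
        split_ifs at ha with h1
        exact h1.1
      have hacc : τ.mem (D.X + D.typ n * D.k + e) = x (D.typ n) e := hr.acc _ ht _ hek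
      have hnext := hsem.next hek
      have hle := hnext.le ht hek
      simp only [Inst.record, and_self, if_true, ha, one_mul] at hle
      have hb := hD.b_le _ ht
      have hLW := lt_two_pow_J (D := D)
      have hpow := hF.pow
      refine WP.put (D.X + D.typ n * D.k + e) (x (D.typ n) e + 2 ^ D.level n) (by simp)
        (by simp [hacc, hτ.pw]; omega) (by simp) (by simp [hacc, hτ.pw]) ?_
      refine WP.assign (D.step n c e) (by simp) (by simp [hnew]) ?_
      refine ⟨by simp [hn'], _, _, ((hr.record hek ha).set rfl _).set rfl _, ?_, hnext, hfeas',
        step_lt _ _ _, by simp, by simp⟩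
      exact Rows.put_of_lt (σ := τ) hrows' (by have := cell_bound ht hek; omega) _
    · intro ha
      have ha : D.act n = 0 := by simpa [hτ.act] using ha
      refine WP.skip ?_
      refine WP.assign (D.step n c e) (by simp) (by simp [hnew]) ?_
      have hx : D.record n e x = x := by
        ext
        simp [Inst.record, ha]
      exact ⟨by simp [hn'], x, _, (hr.set rfl _).set rfl _, hrows', hx ▸ hsem.next hek, hfeas',
        step_lt _ _ _, by simp, by simp⟩
  · simp [Prog.cell]
    omega
  · exact fun _ h => h

theorem moves_wp (hD : D.Ok) {W : ℕ} (hF : D.Fits W) {σ : View} (hR : D.Ready (fun _ _ => 0) σ)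
    (hrows : D.Rows 0 σ.mem) (hfeas : D.Feas 0 0) :
    WP W Prog.moves (D.total * (130 * D.k + 240) + 20)
      (fun τ => ∃ x, D.Ready x τ ∧ D.Sol x) σ := by
  have hk := k_lt hD hF
  have ht := total_lt hF
  apply WP.mono (R := fun τ => ∃ x, D.Ready x τ ∧ D.Sol x)
  · apply WP.seq
    refine WP.assign 0 (by simp; omega) (by simp) ?_
    apply WP.forLoop (D.Moved) D.total (by omega)
    · exact ⟨_, 0, (hR.set rfl _).set rfl _, hrows, Sem.zero, hfeas, N_pos, by simp, by simp⟩
    · intro n τ h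
      obtain ⟨x, c, h⟩ := h
      exact ⟨trivial, h.1.glob.E, h.2.2.2.2.2.1⟩
    · exact fun n τ hn h => move_wp hD hF hn h
    · intro τ h
      obtain ⟨x, c, h⟩ := h
      exact ⟨x, h.1, h.2.2.1.sol hD h.2.2.2.1.check⟩
  · simp
    have : D.total * (130 * D.k + 220 + 6 + 5 + 1) ≤ D.total * (130 * D.k + 240) :=
      Nat.mul_le_mul_left _ (by omega)
    omega
  · exact fun _ h => h

theorem Sol.congr (hD : D.Ok) {x y : ℕ → ℕ → ℕ} (h : D.Sol x)
    (hxy : ∀ t < D.T, ∀ e < D.k, y t e = x t e) : D.Sol y := by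
  refine ⟨fun t ht => ?_, fun i hi => ?_⟩
  · rw [← h.sum t ht]
    exact sum_congr rfl fun e he => hxy t ht e (mem_range.1 he)
  · convert h.cover i hi using 2
    exact sum_congr rfl fun t ht =>
      hxy t (mem_range.1 ht) _ (hD.f_lt t (mem_range.1 ht) i hi)

theorem output_wp (hD : D.Ok) {W : ℕ} (hF : D.Fits W) {σ : View} {x : ℕ → ℕ → ℕ}
    (hR : D.Ready x σ) (hx : D.Sol x) :
    WP W Prog.output (D.T * D.k * 40 + 20)
      (fun τ => τ.reg .ans = 1 ∧ D.Sol fun t e => τ.mem (t * D.k + e)) σ := by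
  have hk := k_lt hD hF
  have hZ := Z_lt hF
  have hQ := Q_le (D := D)
  have hX : D.X = 4 + D.T * D.k + D.T := rfl
  apply WP.mono (R := fun τ => τ.reg .ans = 1 ∧ D.Sol fun t e => τ.mem (t * D.k + e))
  · apply WP.seq
    -- The copy overwrites the input, so only the registers are kept. The sources lie above the
    -- targets: `X + i` is at least `T * k` and is still intact when it is read.
    apply WP.forLoop (fun i τ => D.Glob τ ∧ τ.reg .i = i ∧ i ≤ D.T * D.k ∧
      (∀ a < i, τ.mem a = σ.mem (D.X + a)) ∧ ∀ a ≥ D.T * D.k, τ.mem a = σ.mem a) (D.T * D.k)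
      (by omega)
    · exact ⟨(hR.set rfl _).glob, by simp, by omega, fun a ha => by omega, fun _ _ => rfl⟩
    · intro i τ h
      refine ⟨?_, by simp [h.1.T, h.1.k], h.2.1⟩
      simp [h.1.T, h.1.k]
      omega
    · intro i τ hi h
      obtain ⟨hg, hir, hile, hlt, hge⟩ := h
      refine WP.put i (σ.mem (D.X + i)) (by simp) (by simp [hg.X, hir]; omega) (by simp [hir])
        (by simp [hg.X, hir, hge (D.X + i) (by omega)]) ?_
      refine ⟨hir, (Glob.congr (τ := τ.put _ _) hg fun _ _ => rfl).set rfl _, by simp, hi, fun a ha => ?_,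
        fun a ha => ?_⟩
      · simp only [View.set_mem, View.put_mem]
        split_ifs with h1
        · rw [h1]
        · exact hlt a (by omega)
      · simp only [View.set_mem, View.put_mem]
        rw [if_neg (by omega), hge a ha]
    · intro τ h
      refine WP.assign 1 (by simp; omega) (by simp) ⟨by simp, hx.congr hD fun t ht e he => ?_⟩
      have := cell_bound ht he
      rw [View.set_mem, h.2.2.2.1 _ this, ← add_assoc, hR.acc t ht e he]
  · simp
    omega
  · exact fun _ h => h

end Moves

/-! ### Correctness of the initialization. -/

section Init

/-- The memory contains the input and nothing else. -/
structure Start (D : Inst) (mem : ℕ → ℕ) : Prop where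
  k : mem 0 = D.k
  L : mem 1 = D.L
  d : mem 2 = D.d
  T : mem 3 = D.T
  input : D.Input mem
  zero : ∀ a, D.X ≤ a → mem a = 0

/-- After `j` rounds of the loop in `Prog.init`, the state before it being `σ`. -/
structure Doubled (σ : View) (j : ℕ) (τ : View) : Prop where
  frame : ∀ x : Var, x ∉ [Var.pw, .J] → τ.reg x = σ.reg x
  pw : τ.reg .pw = 2 ^ j
  mem : ∀ a < D.Q, τ.mem a = σ.mem a
  powers : ∀ i ≤ j, τ.mem (D.Q + i) = 2 ^ i
  J : τ.reg .J = j

theorem J_pos (hD : D.Ok) : 1 ≤ D.J := by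
  have h1 := lt_two_pow_J (D := D)
  have := hD.k_pos
  have := hD.L_pos
  by_contra h
  rw [show D.J = 0 by omega, pow_zero] at h1
  omega

theorem S_lt {W : ℕ} (hD : D.Ok) (hF : D.Fits W) : 2 * D.S < W := by
  have h1 := hF.cells
  have h2 := B_le_N hD
  have h3 : 1 * D.N ≤ (D.total + 1) * D.N := Nat.mul_le_mul_right _ (by omega)
  unfold B at h2
  unfold S
  omega

theorem init_wp (hD : D.Ok) {W : ℕ} (hF : D.Fits W) {σ : View} (h : D.Start σ.mem) :
    WP W Prog.init (D.J * 50 + D.k * 30 + 200) (fun τ => D.Ready (fun _ _ => 0) τ) σ := by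
  have hk := k_lt hD hF
  have hZ := Z_lt hF
  have hQ := Q_le (D := D)
  have hS := S_lt hD hF
  have hNW := N_lt hF
  have hBN := B_le_N hD
  have hX : D.X = 4 + D.T * D.k + D.T := rfl
  have hQ' : D.Q = D.X + D.T * D.k := rfl
  have hZ' : D.Z = D.Q + D.J + 1 := rfl
  have hS' : D.S = D.T * (D.k + 1) + 1 := rfl
  have hB' : D.B = 2 * (D.T * (D.k + 1)) + 3 := rfl
  have hpow := hF.pow
  have hL := lt_two_pow_J (D := D)
  have htot := total_lt hF
  apply WP.mono (R := fun τ => D.Ready (fun _ _ => 0) τ)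
  · apply WP.seq
    refine WP.assign D.k (by simp; omega) (by simp [h.k]) ?_
    apply WP.seq
    refine WP.assign D.L (by simp; omega) (by simp [h.L]) ?_
    apply WP.seq
    refine WP.assign D.d (by simp; omega) (by simp [h.d]) ?_
    apply WP.seq
    refine WP.assign D.T (by simp; omega) (by simp [h.T]) ?_
    apply WP.seq
    refine WP.assign (D.k + 1) (by simp; omega) (by simp) ?_
    apply WP.seq
    refine WP.assign D.S (by simp; omega) (by simp [hS']) ?_
    apply WP.seq
    refine WP.assign D.B (by simp; omega) (by simp [hB']) ?_
    apply WP.seq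
    refine WP.assign D.X (by simp; omega) (by simp [hX]) ?_
    apply WP.seq
    refine WP.assign D.Q (by simp; omega) (by simp [hQ']) ?_
    apply WP.seq
    refine WP.assign 1 (by simp; omega) (by simp) ?_
    apply WP.seq
    refine WP.assign 0 (by simp; omega) (by simp) ?_
    apply WP.seq
    refine WP.put D.Q 1 (by simp) (by simp; omega) (by simp) (by simp) ?_
    generalize hσ₁ : (View.put _ _ _ : View) = σ₁
    have rk : σ₁.reg .k = D.k := by simp [← hσ₁]
    have rL : σ₁.reg .L = D.L := by simp [← hσ₁]
    have rd : σ₁.reg .d = D.d := by simp [← hσ₁]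
    have rT : σ₁.reg .T = D.T := by simp [← hσ₁]
    have rK : σ₁.reg .K = D.k + 1 := by simp [← hσ₁]
    have rS : σ₁.reg .S = D.S := by simp [← hσ₁]
    have rB : σ₁.reg .B = D.B := by simp [← hσ₁]
    have rX : σ₁.reg .X = D.X := by simp [← hσ₁]
    have rQ : σ₁.reg .Q = D.Q := by simp [← hσ₁]
    have rpw : σ₁.reg .pw = 1 := by simp [← hσ₁]
    have rJ : σ₁.reg .J = 0 := by simp [← hσ₁]
    have rmem : ∀ a, σ₁.mem a = if a = D.Q then 1 else σ.mem a := by simp [← hσ₁]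
    clear hσ₁
    apply WP.seq
    apply WP.whileLoop (D.Doubled σ₁) D.J
    · refine ⟨fun _ _ => rfl, by simp [rpw], fun _ _ => rfl, fun i hi => ?_, by simp [rJ]⟩
      obtain rfl : i = 0 := by omega
      simp [rmem]
    · intro j τ _ hτ
      have e1 := (hτ.frame .L (by simp)).trans rL
      have e2 := (hτ.frame .k (by simp)).trans rk
      have e3 : j < D.J ↔ 2 ^ j < D.L + D.k + 1 := Nat.lt_clog_iff_pow_lt (by norm_num)
      refine ⟨by simp [e1, e2]; omega, ?_⟩
      rw [e3]
      simp [e1, e2, hτ.pw, Nat.sub_eq_zero_iff_le]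
    · intro j τ hj hτ
      have e3 := (hτ.frame .Q (by simp)).trans rQ
      have e4 : 2 ^ (j + 1) ≤ 2 ^ D.J := Nat.pow_le_pow_right (by norm_num) hj
      have e5 := pow_succ 2 j
      apply WP.seq
      refine WP.assign (2 ^ (j + 1)) (by simp [hτ.pw]; omega) (by simp [hτ.pw, e5]) ?_
      apply WP.seq
      refine WP.assign (j + 1) (by simp [hτ.J]; omega) (by simp [hτ.J]) ?_
      refine WP.put (D.Q + (j + 1)) (2 ^ (j + 1)) (by simp [e3]; omega) (by simp) (by simp [e3])
        (by simp) ?_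
      refine ⟨fun x hx => ?_, by simp, fun a ha => ?_, fun i hi => ?_, by simp⟩
      · rw [← hτ.frame x hx]
        simp at hx
        simp [hx]
      · simp only [View.set_mem, View.put_mem]
        rw [if_neg (by omega), hτ.mem a ha]
      · simp only [View.set_mem, View.put_mem]
        split_ifs with h1
        · rw [show i = j + 1 by omega]
        · exact hτ.powers i (by omega)
    · intro τ hτ
      have e1 := (hτ.frame .L (by simp)).trans rL
      have e2 := (hτ.frame .d (by simp)).trans rd
      have e3 := (hτ.frame .Q (by simp)).trans rQ
      have e4 := (hτ.frame .S (by simp)).trans rS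
      have e5 := (hτ.frame .B (by simp)).trans rB
      have e6 := (hτ.frame .k (by simp)).trans rk
      have e7 := (hτ.frame .T (by simp)).trans rT
      have e8 := (hτ.frame .K (by simp)).trans rK
      have e9 := (hτ.frame .X (by simp)).trans rX
      have hmem : ∀ a < D.Q, τ.mem a = σ.mem a := fun a ha => by
        rw [hτ.mem a ha, rmem, if_neg (by omega)]
      apply WP.seq
      refine WP.assign D.G (by simp [hτ.pw, e2]; omega) (by simp [hτ.pw, e1, e2, G]) ?_
      apply WP.seq
      refine WP.assign (D.G / 2 ^ D.J) (by simp) (by simp [hτ.pw]) ?_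
      apply WP.seq
      refine WP.assign D.Z (by simp [hτ.J, e3]; omega) (by simp [hτ.J, e3, hZ']) ?_
      apply WP.seq
      refine WP.assign D.total (by simp [hτ.J, e4]; change D.total < W; omega)
        (by simp [hτ.J, e4, total]) ?_
      apply WP.seq
      refine WP.assign 1 (by simp; omega) (by simp) ?_
      -- `N` gets its value only at the end of this loop, so `Glob` is asserted with `N` replaced by
      -- its final value.
      apply WP.forLoop (fun i υ => υ.mem = τ.mem ∧ υ.reg .i = i ∧ υ.reg .N = D.B ^ i ∧
        υ.reg .k = D.k ∧ υ.reg .B = D.B ∧ D.Glob (υ.set .N D.N)) D.k (by omega)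
      · refine ⟨by simp, by simp, by simp, by simp [e6], by simp [e5], ?_⟩
        constructor <;> simp [hτ.J, e1, e2, e3, e4, e5, e6, e7, e8, e9]
      · exact fun i υ hυ => ⟨trivial, hυ.2.2.2.1, hυ.2.1⟩
      · intro i υ hi hυ
        obtain ⟨f1, f2, f3, f4, f5, f6⟩ := hυ
        have hp : D.B ^ (i + 1) ≤ D.N := Nat.pow_le_pow_right B_pos hi
        have hp' := pow_succ D.B i
        refine WP.assign (D.B ^ (i + 1)) (by simp [f3, f5]; omega) (by simp [f3, f5, hp']) ?_
        refine ⟨by simp [f2], by simp [f1], by simp, by simp, by simp [f4], by simp [f5], ?_⟩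
        refine f6.congr fun x hx => ?_
        have : x ≠ .i := by rintro rfl; cases hx
        by_cases hN : x = .N <;> simp [this, hN]
      · intro υ hυ
        obtain ⟨f1, f2, f3, f4, f5, f6⟩ := hυ
        have hg : D.Glob υ := f6.congr fun x _ => by
          by_cases hx : x = .N
          · subst hx
            rw [View.set_reg, if_pos rfl]
            exact f3
          · simp [hx]
        refine ⟨hg, ⟨fun t ht i hi => ?_, fun t ht => ?_⟩, fun j hj => ?_, fun t ht e he => ?_⟩
        · have := cell_bound ht hi
          rw [f1, hmem _ (by omega), h.input.f t ht i hi]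
        · rw [f1, hmem _ (by omega), h.input.b t ht]
        · rw [f1, hτ.powers j hj]
        · have := cell_bound ht he
          rw [f1, hmem _ (by omega), h.zero _ (by omega)]
  · simp
    clear * -
    omega
  · exact fun _ h => h

end Init

/-! ### Correctness of the whole program. -/

/-- A bound for the number of steps that the program takes. -/
def time (D : Inst) : ℕ :=
  (D.J * 50 + D.k * 30 + 200) + (D.N * (60 * D.k + 60) + 20) +
    (D.total * (D.N * (D.k * (130 * D.k + 210) + 50) + 60) + 20) +
    (D.total * (130 * D.k + 240) + 20) + (D.T * D.k * 40 + 20) + 20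

theorem main_wp (hD : D.Ok) {W : ℕ} (hF : D.Fits W) {σ : View} (h : D.Start σ.mem) :
    WP W Prog.main D.time (fun τ => (τ.reg .ans = 1 ∧ D.Sol fun t e => τ.mem (t * D.k + e)) ∨
      (τ.reg .ans = 0 ∧ ¬ ∃ x, D.Sol x)) σ := by
  have hk := k_lt hD hF
  apply WP.mono (R := fun τ => (τ.reg .ans = 1 ∧ D.Sol fun t e => τ.mem (t * D.k + e)) ∨
      (τ.reg .ans = 0 ∧ ¬ ∃ x, D.Sol x))
  · apply WP.seq
    refine (init_wp hD hF h).mono le_rfl fun τ hR => ?_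
    apply WP.seq
    refine (finalRow_wp hD hF hR).mono le_rfl fun τ h => ?_
    obtain ⟨hR, hrows⟩ := h
    apply WP.seq
    refine (innerRows_wp hD hF hR hrows).mono le_rfl fun τ h => ?_
    obtain ⟨hR, hrows⟩ := h
    -- The start is state `0` before step `0`, whose cell is the one at `Z`.
    have hfeas := (hrows 0 le_rfl (Nat.zero_le _) 0 N_pos).feas
    simp only [zero_mul, add_zero] at hfeas
    apply WP.cond (by simp)
    · intro h0
      apply WP.seq
      refine (moves_wp hD hF hR hrows (hfeas.2 (by simpa [hR.glob.Z] using h0))).mono le_rfl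
        fun τ h => ?_
      obtain ⟨x, hR, hx⟩ := h
      exact (output_wp hD hF hR hx).mono le_rfl fun υ h => .inl h
    · intro h0
      refine WP.assign 0 (by simp; omega) (by simp) (.inr ⟨by simp, ?_⟩)
      rintro ⟨x, hx⟩
      exact hfeas.1 (feas_of_sol hD hx) (by simpa [hR.glob.Z] using h0)
  · simp [time]
    omega
  · exact fun _ h => h

end Inst

/-! ### Bounds on word size and running time. -/

namespace Inst

section Bounds

variable {D : Inst}

/-- The sum is traded for a product, $L+k+1\le (L+1)(k+1)$, and each factor is bounded by a power of
two. -/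
theorem J_le : D.J ≤ Nat.log 2 D.L + D.k + 1 := by
  refine Nat.clog_le_of_le_pow ?_
  have h1 : D.L < 2 ^ (Nat.log 2 D.L + 1) := Nat.lt_pow_succ_log_self (by norm_num) _
  have h2 : D.k < 2 ^ D.k := Nat.lt_two_pow_self
  have h3 : (D.L + 1) * (D.k + 1) ≤ 2 ^ (Nat.log 2 D.L + 1) * 2 ^ D.k := Nat.mul_le_mul h1 h2
  rw [← pow_add] at h3
  rw [show Nat.log 2 D.L + D.k + 1 = Nat.log 2 D.L + 1 + D.k by omega]
  have h4 : 0 ≤ D.L * D.k := Nat.zero_le _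
  nlinarith

theorem two_pow_J_le (hD : D.Ok) : 2 ^ D.J ≤ 2 * (D.L + D.k) := by
  have h1 : 2 ^ (D.J - 1) < D.L + D.k + 1 :=
    Nat.pow_pred_clog_lt_self (by norm_num) (by have := hD.k_pos; omega)
  have h2 : 2 ^ D.J = 2 ^ (D.J - 1) * 2 := by
    rw [← pow_succ, Nat.sub_add_cancel (J_pos hD)]
  omega

/-- The base of the bounds. -/
def M (D : Inst) : ℕ := (D.T + 1) * D.k

theorem two_le_M (hD : D.Ok) : 2 ≤ D.M :=
  Nat.mul_le_mul (Nat.succ_le_succ hD.T_pos) hD.k_pos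

theorem T_lt_M (hD : D.Ok) : D.T + 1 ≤ D.M := Nat.le_mul_of_pos_right _ hD.k_pos

theorem mul_le_M : D.T * D.k + D.k = D.M := (Nat.succ_mul _ _).symm

theorem S_le (hD : D.Ok) : D.S ≤ 2 * D.M := by
  have h1 := T_lt_M hD
  have h2 := mul_le_M (D := D)
  unfold S
  rw [mul_add]
  omega

/-- $B\le 4M\le M^3$; as $M\ge 2$, constants are absorbed into the exponent. -/
theorem N_le (hD : D.Ok) : D.N ≤ D.M ^ (3 * D.k) := by
  have h1 := T_lt_M hD
  have h2 := mul_le_M (D := D)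
  have h3 := two_le_M hD
  have h4 := hD.k_pos
  rw [pow_mul]
  refine Nat.pow_le_pow_left ?_ _
  calc D.B ≤ 4 * D.M := by
        unfold B
        rw [mul_add]
        omega
    _ ≤ D.M ^ 2 * D.M := Nat.mul_le_mul_right _ (by nlinarith)
    _ = D.M ^ 3 := by ring

/-- $18+3k\le 21k$ for $k\ge 1$; this is the source of the constant $21$. -/
theorem pow_mul_le (hD : D.Ok) : D.M ^ 18 * D.M ^ (3 * D.k) ≤ D.M ^ (21 * D.k) := by
  rw [← pow_add]
  have := hD.k_pos
  have := two_le_M hD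
  exact Nat.pow_le_pow_right (by omega) (by omega)

/-- Addresses in the table dominate. The crude bound $\log_2 L\le L$ suffices here, because the
allowed word size contains the factor $L+d$. -/
theorem fits (hD : D.Ok) {W : ℕ} (hW : D.M ^ (21 * D.k) * (D.L + D.d) ≤ W) : D.Fits W := by
  have hM := two_le_M hD
  have h1 := T_lt_M hD
  have h2 := mul_le_M (D := D)
  have hk := hD.k_pos
  have hL := hD.L_pos
  have hS := S_le hD
  have hN := N_le hD
  have hJ := J_le (D := D)
  have hlog : Nat.log 2 D.L ≤ D.L := Nat.log_le_self _ _
  have h2J := two_pow_J_le hD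
  have hA : 1 ≤ D.M ^ (3 * D.k) := Nat.one_le_pow _ _ (by omega)
  set A := D.M ^ (3 * D.k)
  set Y := D.L + D.d
  have hY : 1 ≤ Y := by omega
  have hpow : D.M ^ 18 * A * Y ≤ W := (Nat.mul_le_mul_right Y (pow_mul_le hD)).trans hW
  have hYM : Y ≤ D.M * Y := Nat.le_mul_of_pos_left _ (by omega)
  have hMM : D.M ≤ D.M * Y := Nat.le_mul_of_pos_right _ hY
  have hMY : D.M * Y ≤ D.M ^ 2 * A * Y := by
    refine Nat.mul_le_mul_right _ ?_
    calc D.M = D.M * 1 * 1 := by ring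
      _ ≤ D.M * D.M * A := by gcongr; omega
      _ = D.M ^ 2 * A := by ring
  have hpos : 1 ≤ D.M ^ 2 * A * Y := Nat.mul_pos (Nat.mul_pos (by positivity) hA) hY
  have hbig : 32 * (D.M ^ 2 * A * Y) ≤ D.M ^ 18 * A * Y := by
    calc 32 * (D.M ^ 2 * A * Y) = 2 ^ 5 * (D.M ^ 2 * A * Y) := by norm_num
      _ ≤ D.M ^ 16 * (D.M ^ 2 * A * Y) := by
        refine Nat.mul_le_mul_right _ ?_
        exact (Nat.pow_le_pow_left hM 5).trans (Nat.pow_le_pow_right (by omega) (by norm_num))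
      _ = D.M ^ 18 * A * Y := by ring
  have hJY : D.J ≤ 3 * (D.M * Y) := by omega
  constructor
  · have ht : D.total + 1 ≤ 7 * (D.M ^ 2 * Y) := by
      have : D.J * D.S ≤ 3 * (D.M * Y) * (2 * D.M) := Nat.mul_le_mul hJY hS
      have h3 : 1 ≤ D.M ^ 2 * Y := Nat.mul_pos (by positivity) hY
      unfold total
      nlinarith
    have htN : (D.total + 1) * D.N ≤ 7 * (D.M ^ 2 * A * Y) :=
      (Nat.mul_le_mul ht hN).trans_eq (by ring)
    have : D.Z ≤ 11 * (D.M * Y) := by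
      unfold Z Q X
      omega
    omega
  · omega

theorem time_le (hD : D.Ok) : D.time ≤ D.M ^ 17 * D.M ^ (3 * D.k) * (Nat.log 2 D.L + 1) := by
  have hM := two_le_M hD
  have h1 := T_lt_M hD
  have h2 := mul_le_M (D := D)
  have hk := hD.k_pos
  have hS := S_le hD
  have hN := N_le hD
  have hJ := J_le (D := D)
  have hA : 1 ≤ D.M ^ (3 * D.k) := Nat.one_le_pow _ _ (by omega)
  set A := D.M ^ (3 * D.k)
  set l := Nat.log 2 D.L + 1
  have hl : 1 ≤ l := by omega
  have hkM : D.k ≤ D.M := by omega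
  have hTkM : D.T * D.k ≤ D.M := by omega
  have hJl : D.J ≤ 2 * (D.M * l) := by
    have h3 : l ≤ D.M * l := Nat.le_mul_of_pos_left _ (by omega)
    have h4 : D.M ≤ D.M * l := Nat.le_mul_of_pos_right _ hl
    omega
  -- Every summand of `time` is compared with the one product `M ^ 4 * A * l`.
  have hmono : ∀ a b c, a ≤ D.M ^ 4 → b ≤ A → c ≤ l → a * b * c ≤ D.M ^ 4 * A * l :=
    fun a b c ha hb hc => Nat.mul_le_mul (Nat.mul_le_mul ha hb) hc
  have hM4 : D.M ≤ D.M ^ 4 := Nat.le_self_pow (by norm_num) _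
  have hM3 : D.M ^ 3 ≤ D.M ^ 4 := Nat.pow_le_pow_right (by omega) (by norm_num)
  have ht : D.total ≤ 4 * (D.M ^ 2 * l) := by
    have : D.J * D.S ≤ 2 * (D.M * l) * (2 * D.M) := Nat.mul_le_mul hJl hS
    unfold total
    nlinarith
  have e1 : D.J * 50 ≤ 100 * (D.M ^ 4 * A * l) := by
    have := hmono D.M 1 l hM4 hA le_rfl
    rw [mul_one] at this
    omega
  have e2 : D.k * 30 ≤ 30 * (D.M ^ 4 * A * l) := by
    have := hmono D.M 1 1 hM4 hA hl
    omega
  have e3 : 1 ≤ D.M ^ 4 * A * l := hmono 1 1 1 (by omega) hA hl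
  have e4 : D.N * (60 * D.k + 60) ≤ 120 * (D.M ^ 4 * A * l) := by
    have h3 : D.N * (60 * D.k + 60) ≤ A * (120 * D.M) := Nat.mul_le_mul hN (by omega)
    have h4 := hmono D.M A 1 hM4 le_rfl hl
    rw [mul_one, mul_comm] at h4
    rw [mul_left_comm] at h3
    omega
  have e5 : D.total * (D.N * (D.k * (130 * D.k + 210) + 50) + 60) ≤
      1800 * (D.M ^ 4 * A * l) := by
    have h3 : D.k * (130 * D.k + 210) + 50 ≤ 390 * D.M ^ 2 := by
      have : D.k * (130 * D.k + 210) ≤ D.M * (130 * D.M + 210) := by gcongr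
      nlinarith
    have h4 : D.N * (D.k * (130 * D.k + 210) + 50) + 60 ≤ 450 * (A * D.M ^ 2) := by
      have h5 := Nat.mul_le_mul hN h3
      have h6 : 1 ≤ A * D.M ^ 2 := Nat.mul_pos hA (by positivity)
      rw [mul_left_comm] at h5
      linarith
    have h5 := Nat.mul_le_mul ht h4
    have h6 : 4 * (D.M ^ 2 * l) * (450 * (A * D.M ^ 2)) = 1800 * (D.M ^ 4 * A * l) := by ring
    rwa [h6] at h5
  have e6 : D.total * (130 * D.k + 240) ≤ 1480 * (D.M ^ 4 * A * l) := by
    have h4 : 130 * D.k + 240 ≤ 370 * D.M := by omega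
    have h5 := Nat.mul_le_mul ht h4
    have h6 : 4 * (D.M ^ 2 * l) * (370 * D.M) = 1480 * (D.M ^ 3 * 1 * l) := by ring
    have h7 := hmono _ 1 l hM3 hA le_rfl
    rw [h6] at h5
    omega
  have e7 : D.T * D.k * 40 ≤ 40 * (D.M ^ 4 * A * l) := by
    have := hmono D.M 1 1 hM4 hA hl
    omega
  -- The coefficients, constants included, add up to $3870\le 2^{12}\le M^{13}$.
  calc D.time ≤ 4096 * (D.M ^ 4 * A * l) := by unfold time; omega
    _ = 2 ^ 12 * (D.M ^ 4 * A * l) := by norm_num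
    _ ≤ D.M ^ 13 * (D.M ^ 4 * A * l) := by
      refine Nat.mul_le_mul_right _ ?_
      exact (Nat.pow_le_pow_left hM 12).trans (Nat.pow_le_pow_right (by omega) (by norm_num))
    _ = D.M ^ 17 * A * l := by ring

theorem time_le_real (hD : D.Ok) :
    (D.time : ℝ) ≤ (D.M : ℝ) ^ (21 * D.k) * max 1 (Real.logb 2 D.L) := by
  have hM := two_le_M hD
  have hl : (Nat.log 2 D.L : ℝ) ≤ Real.logb 2 D.L := by
    exact_mod_cast Real.natLog_le_logb D.L 2
  have h1 : ((Nat.log 2 D.L + 1 : ℕ) : ℝ) ≤ (D.M : ℝ) * max 1 (Real.logb 2 D.L) := by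
    have h2 : (2 : ℝ) ≤ D.M := by exact_mod_cast hM
    have h3 := le_max_left 1 (Real.logb 2 D.L)
    have h4 := le_max_right 1 (Real.logb 2 D.L)
    push_cast
    nlinarith
  calc (D.time : ℝ) ≤ ((D.M ^ 17 * D.M ^ (3 * D.k) * (Nat.log 2 D.L + 1) : ℕ) : ℝ) := by
        exact_mod_cast time_le hD
    _ = (D.M : ℝ) ^ 17 * (D.M : ℝ) ^ (3 * D.k) * ((Nat.log 2 D.L + 1 : ℕ) : ℝ) := by push_cast; ring
    _ ≤ (D.M : ℝ) ^ 17 * (D.M : ℝ) ^ (3 * D.k) * ((D.M : ℝ) * max 1 (Real.logb 2 D.L)) := by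
        gcongr
    _ = ((D.M ^ 18 * D.M ^ (3 * D.k) : ℕ) : ℝ) * max 1 (Real.logb 2 D.L) := by push_cast; ring
    _ ≤ ((D.M ^ (21 * D.k) : ℕ) : ℝ) * max 1 (Real.logb 2 D.L) := by
        gcongr
        exact pow_mul_le hD
    _ = _ := by push_cast; ring

end Bounds

end Inst

/-! ### Strings and tables. -/

section Strings

variable {k L : ℕ}

theorem SameType.eq_iff {u v : Fin k → Fin k} (h : SameType u v) (i j : Fin k) :
    u i = u j ↔ v i = v j := by
  rcases lt_trichotomy i j with hij | rfl | hij
  · exact h i j hij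
  · simp
  · rw [eq_comm, h j i hij, eq_comm]

/-- Every letter at a position corresponds to a letter at a position of the same type. -/
theorem SameType.exists_letter {u v : Fin k → Fin k} (h : SameType u v) (a : Fin k) :
    ∃ b, ∀ i, a = u i ↔ b = v i := by
  by_cases ha : ∃ i, u i = a
  · obtain ⟨j, rfl⟩ := ha
    exact ⟨v j, h.eq_iff j⟩
  -- If `a` is missing, `u` is not surjective, hence not injective, as there are as many letters as
  -- strings. Then `v`, with the same coincidences, is not injective either and also misses a
  -- letter, which serves as `b`.
  · have hu : ¬ Function.Surjective u := fun hs => ha (hs a)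
    rw [← Finite.injective_iff_surjective] at hu
    have hv : ¬ Function.Injective v := fun hv => hu fun i j hij => hv ((h.eq_iff i j).1 hij)
    rw [Finite.injective_iff_surjective] at hv
    obtain ⟨b, hb⟩ := not_forall.1 hv
    exact ⟨b, fun i => ⟨fun hi => absurd ⟨i, hi.symm⟩ ha, fun hi => absurd ⟨i, hi.symm⟩ hb⟩⟩

theorem SameType.symm {u v : Fin k → Fin k} (h : SameType u v) : SameType v u :=
  fun i j hij => (h i j hij).symm

theorem ncard_setOf {α : Type*} [Fintype α] (p : α → Prop) [DecidablePred p] :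
    {a | p a}.ncard = #{a | p a} := by
  rw [Set.ncard_eq_toFinset_card', Set.toFinset_ofPred]

/-- There are functions with prescribed numbers of preimages. -/
theorem exists_card_fiber_eq {α ι : Type*} [Fintype α] [Fintype ι] [DecidableEq ι] (x : ι → ℕ)
    (hx : ∑ e, x e = Fintype.card α) : ∃ g : α → ι, ∀ e, #{a | g a = e} = x e := by
  -- `α` is matched with a disjoint union of blocks of sizes `x e`; the projection to the block
  -- index has the prescribed fibres.
  have hc : Fintype.card α = Fintype.card (Σ e, Fin (x e)) := by simp [hx]
  let f := Fintype.equivOfCardEq hc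
  refine ⟨fun a => (f a).1, fun e => ?_⟩
  rw [← Fintype.card_subtype, ← Fintype.card_fin (x e)]
  exact Fintype.card_congr ((f.subtypeEquiv fun a => Iff.rfl).trans (Equiv.sigmaSubtype e))

variable {s : Fin k → Fin L → Fin k} {rep : Fin (numTypes s) → Fin k → Fin k}

theorem IsTypeListing.exists_typ (h : IsTypeListing s rep) :
    ∃ τ : Fin L → Fin (numTypes s), ∀ j t, SameType (column s j) (rep t) ↔ τ j = t := by
  choose τ hτ using fun j => (h.2 j)
  exact ⟨τ, fun j t => ⟨fun ht => ((hτ j).2 t ht).symm, fun ht => ht ▸ (hτ j).1⟩⟩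

/-- Letters are distributed over the positions of each type in the prescribed numbers, and then
renamed position by position with `SameType.exists_letter`, which preserves agreement with every
string. -/
theorem exists_describes (h : IsTypeListing s rep) {x : Fin (numTypes s) → Fin k → ℕ}
    (hx : ∀ t, ∑ e, x t e = mult s rep t) : ∃ c, Describes s rep x c := by
  classical
  obtain ⟨τ, hτ⟩ := h.exists_typ
  have hm : ∀ t, mult s rep t = Fintype.card {j // τ j = t} := fun t => by
    simp only [mult, hτ]
    rw [ncard_setOf, Fintype.card_subtype]
  choose g hg using fun t => exists_card_fiber_eq (x t) ((hx t).trans (hm t))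
  choose c hc using fun j => ((hτ j (τ j)).2 rfl).symm.exists_letter (g (τ j) ⟨j, rfl⟩)
  refine ⟨c, hx, fun t i => ?_⟩
  rw [← hg, ← ncard_setOf, ← Set.ncard_image_of_injective _ Subtype.val_injective]
  congr 1
  ext j
  simp only [Set.mem_image, Set.mem_ofPred_eq, Subtype.exists, exists_and_right, exists_eq_right, hτ]
  constructor
  · rintro ⟨rfl, hj⟩
    exact ⟨rfl, (hc j i).1 hj⟩
  · rintro ⟨rfl, hj⟩
    exact ⟨rfl, (hc j i).2 hj⟩

theorem hammingDist_add (h : IsTypeListing s rep) (c : Fin L → Fin k) (i : Fin k) :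
    hammingDist c (s i) +
      ∑ t, {j | SameType (column s j) (rep t) ∧ c j = s i j}.ncard = L := by
  classical
  obtain ⟨τ, hτ⟩ := h.exists_typ
  have h1 : ∑ t, {j | SameType (column s j) (rep t) ∧ c j = s i j}.ncard = #{j | c j = s i j} := by
    rw [card_eq_sum_card_fiberwise (f := τ) (t := univ) (by simp)]
    refine sum_congr rfl fun t _ => ?_
    rw [ncard_setOf, filter_filter]
    simp only [hτ, and_comm]
  rw [h1, hammingDist, add_comm]
  simpa using card_filter_add_card_filter_not (s := (univ : Finset (Fin L))) fun j => c j = s i j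

/-- The succinct instance of a list of strings. -/
noncomputable def toInst (s : Fin k → Fin L → Fin k) (d : ℕ)
    (rep : Fin (numTypes s) → Fin k → Fin k) : Inst where
  k := k
  L := L
  d := d
  T := numTypes s
  f t i := if h : t < numTypes s ∧ i < k then rep ⟨t, h.1⟩ ⟨i, h.2⟩ else 0
  b t := if h : t < numTypes s then mult s rep ⟨t, h⟩ else 0

variable {d : ℕ}

theorem toInst_f (t : Fin (numTypes s)) (i : Fin k) : (toInst s d rep).f t i = rep t i := by
  simp [toInst]

theorem toInst_b (t : Fin (numTypes s)) : (toInst s d rep).b t = mult s rep t := by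
  simp [toInst]

theorem toInst_ok (hk : 1 ≤ k) (hL : 1 ≤ L) (h : IsTypeListing s rep) : (toInst s d rep).Ok := by
  refine ⟨hk, ?_, hL, fun t ht i hi => ?_, fun t ht => ?_⟩
  · obtain ⟨t, -⟩ := h.2 ⟨0, hL⟩
    exact t.pos
  · exact (toInst_f ⟨t, ht⟩ ⟨i, hi⟩).trans_lt (rep ⟨t, ht⟩ ⟨i, hi⟩).2
  · refine (toInst_b ⟨t, ht⟩).trans_le ?_
    exact (Set.ncard_le_card _).trans_eq (Nat.card_fin _)

theorem sol_iff {x : ℕ → ℕ → ℕ} : (toInst s d rep).Sol x ↔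
    (∀ t : Fin (numTypes s), ∑ e : Fin k, x t e = mult s rep t) ∧
      ∀ i, L ≤ d + ∑ t : Fin (numTypes s), x t (rep t i) := by
  have hsum : ∀ i : Fin k, ∑ t ∈ range (toInst s d rep).T, x t ((toInst s d rep).f t i) =
      ∑ t : Fin (numTypes s), x t (rep t i) := fun i => by
    refine (sum_range (n := numTypes s) _).trans ?_
    simp only [toInst_f]
  constructor
  · intro h
    refine ⟨fun t => ?_, fun i => ?_⟩
    · rw [← toInst_b (d := d), ← h.sum t t.2]
      exact (sum_range (n := k) fun e => x t e).symm
    · rw [← hsum]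
      exact h.cover i i.2
  · intro h
    refine ⟨fun t ht => ?_, fun i hi => ?_⟩
    · refine ((sum_range (n := k) fun e => x t e).trans (h.1 ⟨t, ht⟩)).trans ?_
      exact (toInst_b ⟨t, ht⟩).symm
    · rw [hsum ⟨i, hi⟩]
      exact h.2 ⟨i, hi⟩

/-- The letters of `c`, renamed to the representative of their type, are counted. As the constraint
is an inequality, it is enough that agreements of `c` remain agreements. -/
theorem exists_sol (h : IsTypeListing s rep) {c : Fin L → Fin k} (hc : IsClosest s d c) :
    ∃ x, (toInst s d rep).Sol x := by
  classical
  obtain ⟨τ, hτ⟩ := h.exists_typ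
  choose g hg using fun j => ((hτ j (τ j)).2 rfl).exists_letter (c j)
  refine ⟨fun t e => #{j | (τ j : ℕ) = t ∧ (g j : ℕ) = e}, sol_iff.2 ⟨fun t => ?_, fun i => ?_⟩⟩
  · simp only [mult, hτ, Fin.val_inj]
    rw [ncard_setOf, card_eq_sum_card_fiberwise (f := g) (t := univ) (by simp)]
    simp only [filter_filter]
  · refine (hammingDist_add h c i).symm.trans_le
      (Nat.add_le_add (hc i) (sum_le_sum fun t _ => ?_))
    rw [ncard_setOf]
    refine card_le_card fun j => ?_
    simp only [mem_filter, mem_univ, true_and, hτ, Fin.val_inj]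
    rintro ⟨rfl, hj⟩
    exact ⟨rfl, (hg j i).1 hj⟩

theorem isClosest_of_describes (h : IsTypeListing s rep) {x : Fin (numTypes s) → Fin k → ℕ}
    (hx : ∀ i, L ≤ d + ∑ t, x t (rep t i)) {c : Fin L → Fin k} (hc : Describes s rep x c) :
    IsClosest s d c := by
  intro i
  have h1 := hammingDist_add h c i
  have h2 := hx i
  simp only [hc.2] at h2
  omega

/-- The flattened representatives form one list indexed by `t * k + i`, which matches the address
arithmetic of the program. -/
theorem start_encode : (toInst s d rep).Start fun n => (encode s d rep).getD n 0 := by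
  have hdiv : ∀ (t : Fin (numTypes s)) (i : Fin k) (h : (t : ℕ) * k + i < numTypes s * k),
      Fin.divNat ⟨t * k + i, h⟩ = t ∧ Fin.modNat ⟨t * k + i, h⟩ = i := fun t i h => by
    constructor <;> ext
    · change (t * k + i) / k = (t : ℕ)
      rw [add_comm, Nat.add_mul_div_right _ _ i.pos, Nat.div_eq_of_lt i.2, zero_add]
    · exact Nat.mul_add_mod_of_lt i.2
  have hflat : (List.ofFn fun t => List.ofFn fun i => (rep t i : ℕ)).flatten =
      List.ofFn fun p : Fin (numTypes s * k) => (rep p.divNat p.modNat : ℕ) := by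
    rw [List.ofFn_mul]
    simp only [hdiv]
  have henc : encode s d rep = k :: L :: d :: numTypes s ::
      ((List.ofFn fun p : Fin (numTypes s * k) => (rep p.divNat p.modNat : ℕ)) ++
        List.ofFn (mult s rep)) := by
    rw [encode, hflat]
    rfl
  refine ⟨by simp [henc]; rfl, by simp [henc]; rfl, by simp [henc]; rfl, by simp [henc]; rfl,
    ⟨fun t ht i hi => ?_, fun t ht => ?_⟩, fun a ha => ?_⟩
  · have h1 : t * k + i < numTypes s * k := Inst.cell_bound (D := toInst s d rep) ht hi
    have h2 : 4 + t * k + i = t * k + i + 1 + 1 + 1 + 1 := by omega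
    refine Eq.trans ?_ (toInst_f ⟨t, ht⟩ ⟨i, hi⟩).symm
    change (encode s d rep).getD (4 + t * k + i) 0 = _
    rw [henc, h2]
    simp only [List.getD_cons_succ]
    rw [List.getD_append _ _ _ _ (by simpa using h1), List.getD_eq_getElem _ _ (by simpa using h1),
      List.getElem_ofFn]
    rw [(hdiv ⟨t, ht⟩ ⟨i, hi⟩ h1).1, (hdiv ⟨t, ht⟩ ⟨i, hi⟩ h1).2]
  · have h2 : 4 + numTypes s * k + t = numTypes s * k + t + 1 + 1 + 1 + 1 := by omega
    refine Eq.trans ?_ (toInst_b ⟨t, ht⟩).symm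
    change (encode s d rep).getD (4 + numTypes s * k + t) 0 = _
    rw [henc, h2]
    simp only [List.getD_cons_succ]
    rw [List.getD_append_right _ _ _ _ (by simp)]
    simp only [List.length_ofFn, Nat.add_sub_cancel_left]
    rw [List.getD_eq_getElem _ _ (by rw [List.length_ofFn]; exact ht), List.getElem_ofFn]
  · refine List.getD_eq_default _ _ ?_
    simp [henc]
    change 4 + numTypes s * k + numTypes s ≤ a at ha
    omega

end Strings

end ClosestString

theorem corollary3 :
    ∃ (P : ClosestString.Prog) (C : ℕ),
      ∀ (k L d : ℕ), 1 ≤ k → 1 ≤ L →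
      ∀ (s : Fin k → Fin L → Fin k)
        (rep : Fin (ClosestString.numTypes s) → Fin k → Fin k),
        ClosestString.IsTypeListing s rep →
      ∀ w : ℕ, ((ClosestString.numTypes s + 1) * k) ^ (C * k) * (L + d) ≤ 2 ^ w →
        ∃ (n : ℕ) (σ : ClosestString.State),
          ClosestString.Exec w P (ClosestString.initState (ClosestString.encode s d rep)) n σ ∧
          (n : ℝ) ≤ (((ClosestString.numTypes s : ℝ) + 1) * (k : ℝ)) ^ (C * k)
              * max 1 (Real.logb 2 (L : ℝ)) ∧
          ClosestString.Solves s d rep σ := by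
  refine ⟨.main, 21, fun k L d hk hL s rep h w hw => ?_⟩
  have hD : (ClosestString.toInst s d rep).Ok := ClosestString.toInst_ok hk hL h
  obtain ⟨n, hn, σ, υ, hx, ha, hr⟩ := ClosestString.Inst.main_wp hD
    (ClosestString.Inst.fits hD hw) (σ := ⟨fun _ => 0, _⟩) ClosestString.start_encode w rfl
    (ClosestString.initState (ClosestString.encode s d rep)) ⟨fun _ => rfl, rfl⟩
  refine ⟨n, σ, hx, ?_, ?_⟩
  · have h1 := (Nat.cast_le (α := ℝ).2 hn).trans (ClosestString.Inst.time_le_real hD)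
    have h2 : ((ClosestString.toInst s d rep).M : ℝ)
        = ((ClosestString.numTypes s : ℝ) + 1) * (k : ℝ) := by
      simp [ClosestString.Inst.M, ClosestString.toInst]
    rw [h2] at h1
    exact h1
  · have h0 : σ.reg 0 = υ.reg .ans := ha.1 .ans
    rcases hr with ⟨h1, h2⟩ | ⟨h1, h2⟩
    · rw [← ha.2] at h2
      obtain ⟨h3, h4⟩ := ClosestString.sol_iff.1 h2
      exact .inl ⟨h0.trans h1, ClosestString.exists_describes h h3, fun c hc =>
        ClosestString.isClosest_of_describes h h4 hc⟩
    · exact .inr ⟨h0.trans h1, fun ⟨c, hc⟩ => h2 (ClosestString.exists_sol h hc)⟩
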